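/- **Theorem (DT lower bound).** Let $n_c,\ell\ge 1$ be integers, $\rho>0$, $\kappa\ge 0$, $0\le\epsilon<1$, and put $\mu_H=\sqrt{\kappa/(1+\kappa)}$, $\sigma_H^2=1/(1+\kappa)$. Consider the SISO Rician block-fading channel $$Y_k=H_k x_k+W_k,\qquad k=1,\dots,\ell,$$ with $x_k,Y_k\in\mathbb C^{n_c}$, $H_k\sim\mathcal{CN}(\mu_H,\sigma_H^2)$, $W_k\sim\mathcal{CN}(0,I_{n_c})$, all of $H_1,\dots,H_\ell,W_1,\dots,W_\ell$ independent, where neither encoder nor decoder knows the realizations of the $H_k$. A code with $M$ messages consists of an encoder $\{1,\dots,M\}\to(\mathbb C^{n_c})^\ell$, $m\mapsto(c_{m,1},\dots,c_{m,\ell})$, with $\|c_{m,k}\|^2=n_c\rho$ for all $m,k$, and a (measurable) decoder $g:(\mathbb C^{n_c})^\ell\to\{1,\dots,M\}$ whose average error probability $\frac1M\sum_{j=1}^M\Pr\{g(Y_1,\dots,Y_\ell)\ne j\mid J=j\}$ is at most $\epsilon$. Let $R^*$ be the supremum of $\log_2(M)/(n_c\ell)$ over all $M$ for which such a code exists. Then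 $$R^*\ \ge\ \max\Big\{\frac{\log_2 M}{n_c\ell}\,:\ M\ge 1,\ \epsilon_{\mathrm{ub}}(M)\le\epsilon\Big\},$$ where the maximum is attained, and $$\epsilon_{\mathrm{ub}}(M)=\mathbb E\Big[\exp\Big\{-\Big[\sum_{k=1}^{\ell}S_k-\log\tfrac{M-1}{2}\Big]^+\Big\}\Big]$$ (with $\log 0=-\infty$, so that $\epsilon_{\mathrm{ub}}(1)=0$), $[a]^+=\max\{0,a\}$, $\log$ the natural logarithm, $$S_k=\frac{\mu_H^2}{\sigma_H^2}+\|\widetilde W_k\|^2-\|W_k\|^2-\log\frac{\sigma_H^2n_c\rho+1}{\sigma_H^2}-\log\Gamma(n_c)-\log\int_0^\infty\frac{e^{-(\rho n_c+\sigma_H^{-2})z}}{\big(\sqrt{\|\widetilde W_k\|^2\rho n_c z}\big)^{n_c-1}}\,I_0\Big(2\sqrt{z\mu_H^2/\sigma_H^4}\Big)\,I_{n_c-1}\Big(2\sqrt{\|\widetilde W_k\|^2\rho n_c z}\Big)\,dz,$$ $I_\nu$ is the modified Bessel function of the first kind, and $\widetilde W_k\in\mathbb C^{n_c}$ has first entry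 $\mu_H\sqrt{n_c\rho}+\sqrt{\sigma_H^2n_c\rho+1}\,(W_k)_1$ and all its other entries equal to those of $W_k$. -/

import Mathlib

open MeasureTheory ProbabilityTheory

noncomputable section

namespace RicianBlockFading

/-- The law `CN(m, v)` of a circularly symmetric complex Gaussian with mean `m` and variance `v`:
real and imaginary part are independent real Gaussians of variance `v / 2`. -/
def complexGaussian (m : ℂ) (v : ℝ) : Measure ℂ :=
  ((gaussianReal m.re (v / 2).toNNReal).prod (gaussianReal m.im (v / 2).toNNReal)).map
    (fun p : ℝ × ℝ => (⟨p.1, p.2⟩ : ℂ))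

/-- Mean of the fading coefficient for Rician factor `κ`. -/
def fadingMean (κ : ℝ) : ℝ := Real.sqrt (κ / (1 + κ))

/-- Variance of the fading coefficient for Rician factor `κ`. -/
def fadingVar (κ : ℝ) : ℝ := (1 + κ)⁻¹

/-- A packet: `ℓ` blocks, each a vector in `ℂ ^ nc`. -/
abbrev Packet (ℓ nc : ℕ) : Type := Fin ℓ → Fin nc → ℂ

/-- Squared Euclidean norm of a complex vector. -/
def sqNorm {nc : ℕ} (v : Fin nc → ℂ) : ℝ := ∑ i, ‖v i‖ ^ 2

/-- Law of the additive noise `(W_1, …, W_ℓ)`: all entries i.i.d. `CN(0, 1)`. -/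
def noiseLaw (ℓ nc : ℕ) : Measure (Packet ℓ nc) :=
  Measure.pi fun _ => Measure.pi fun _ => complexGaussian 0 1

/-- Law of the fading coefficients `(H_1, …, H_ℓ)`: i.i.d. `CN(μ_H, σ_H²)`. -/
def fadingLaw (κ : ℝ) (ℓ : ℕ) : Measure (Fin ℓ → ℂ) :=
  Measure.pi fun _ => complexGaussian (fadingMean κ : ℂ) (fadingVar κ)

/-- Law of the channel output `Y_k = H_k x_k + W_k`, `k = 1, …, ℓ`, for the input packet `x`,
where fading and noise are independent. -/
def outputLaw (κ : ℝ) {ℓ nc : ℕ} (x : Packet ℓ nc) : Measure (Packet ℓ nc) :=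
  ((fadingLaw κ ℓ).prod (noiseLaw ℓ nc)).map
    (fun p : (Fin ℓ → ℂ) × Packet ℓ nc => fun k i => p.1 k * x k i + p.2 k i)

/-- An `(ℓ, nc, M, ε, ρ)`-code for the Rician block-fading channel with Rician factor `κ`:
every subcodeword has power exactly `nc ρ`, the decoder sees only the channel output,
and the average error probability is at most `ε`. -/
structure Code (κ ρ ε : ℝ) (ℓ nc M : ℕ) where
  /-- the encoder -/
  enc : Fin M → Packet ℓ nc
  /-- the decoder -/
  dec : Packet ℓ nc → Fin M
  measurable_dec : Measurable dec
  power : ∀ m k, sqNorm (enc m k) = nc * ρ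
  error_le : (1 / (M : ℝ)) * ∑ j, (outputLaw κ (enc j)).real {y | dec y ≠ j} ≤ ε

/-- Rate of a code with `M` messages, in bits per channel use. -/
def rate (ℓ nc M : ℕ) : ℝ := Real.logb 2 M / (nc * ℓ)

/-- The maximum coding rate `R*`: the supremum, in the extended reals, of the rates of all codes. -/
def maxRate (κ ρ ε : ℝ) (ℓ nc : ℕ) : EReal :=
  sSup {r : EReal | ∃ M : ℕ, Nonempty (Code κ ρ ε ℓ nc M) ∧ r = (rate ℓ nc M : EReal)}

/-- The modified Bessel function of the first kind `I_m(x)` of order `m ∈ ℕ`. -/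
def besselI (m : ℕ) (x : ℝ) : ℝ :=
  ∑' k : ℕ, (x / 2) ^ (2 * k + m) / ((k.factorial : ℝ) * ((k + m).factorial : ℝ))

/-- The vector `w̃` formed from the noise vector `w` of one block: the first entry is
`μ_H √(nc ρ) + √(σ_H² nc ρ + 1) w_1`, the others are those of `w`. -/
def tildeNoise (κ ρ : ℝ) {nc : ℕ} (w : Fin nc → ℂ) : Fin nc → ℂ := fun i =>
  if i.val = 0 then
    ((fadingMean κ * Real.sqrt (nc * ρ) : ℝ) : ℂ)
      + ((Real.sqrt (fadingVar κ * nc * ρ + 1) : ℝ) : ℂ) * w i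
  else w i

/-- The integral in the definition of `S_k`, as a function of `s = ‖w̃_k‖²`. -/
def besselIntegral (κ ρ : ℝ) (nc : ℕ) (s : ℝ) : ℝ :=
  ∫ z in Set.Ioi (0 : ℝ),
    Real.exp (-(ρ * nc + (fadingVar κ)⁻¹) * z) / Real.sqrt (s * ρ * nc * z) ^ (nc - 1)
      * besselI 0 (2 * Real.sqrt (z * fadingMean κ ^ 2 / fadingVar κ ^ 2))
      * besselI (nc - 1) (2 * Real.sqrt (s * ρ * nc * z))

/-- The random variable `S_k`, as a function of the noise vector `w = w_k` of block `k`. -/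
def blockS (κ ρ : ℝ) {nc : ℕ} (w : Fin nc → ℂ) : ℝ :=
  fadingMean κ ^ 2 / fadingVar κ + sqNorm (tildeNoise κ ρ w) - sqNorm w
    - Real.log ((fadingVar κ * nc * ρ + 1) / fadingVar κ)
    - Real.log (Real.Gamma nc)
    - Real.log (besselIntegral κ ρ nc (sqNorm (tildeNoise κ ρ w)))

/-- `ε_ub(M) = E[exp(-[∑_k S_k - log((M - 1) / 2)]⁺)]` for `M ≥ 1`.
For `M = 1`, `log 0 = -∞` makes the expectation `0`. -/
def epsUb (κ ρ : ℝ) (ℓ nc M : ℕ) : ℝ :=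
  if M ≤ 1 then 0
  else ∫ w : Packet ℓ nc,
    Real.exp (-(max 0 ((∑ k, blockS κ ρ (w k)) - Real.log (((M : ℝ) - 1) / 2)))) ∂(noiseLaw ℓ nc)

end RicianBlockFading

end

open scoped ENNReal RealInnerProductSpace

/-! The proof is random coding with the dependence-testing decoder. The `ℓ` blocks of each codeword
are drawn independently and uniformly on the sphere of squared radius `nc ρ` in `ℂ ^ nc`. With `p`
the transition density and `q` the output density under this input, `dependence_testing_bound` gives
a codebook whose average error is at most the mean over codewords of `∫ min (p, (M - 1) / 2 * q)`.

This integral is the same for every codeword. A unitary map in each block moves the codeword to the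
first axis, preserves Lebesgue measure, and leaves `q` unchanged because `q` depends on each block
only through its norm (`lintegral_min_spherePoint`). For the axis input the output has independent
complex Gaussian entries and is distributed as `tildeNoise` of the noise, so `p` is explicit.

For `q`, the average over the sphere with the fading fixed is a `₀F₁` function
(`lintegral_toSphere_exp_inner`). Averaging over the fading then needs only `‖H‖ ^ 2`, which is
noncentral chi-squared and contributes the factor `I_0` (`mixDensity_eq_besselIntegral`). Hence `q /
p = exp (-∑ S_k)`, and writing `min (p, γ q) = p * min (1, γ q / p)` turns the bound into `epsUb`.

The maximum is attained because `epsUb` tends to `1 > ε`, so only finitely many `M` are admissible.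
-/

/-! ### Product densities, polar coordinates, power series coefficients -/

theorem lintegral_pi_fin_prod {α : Type*} [MeasurableSpace α] {n : ℕ} (μ : Fin n → Measure α)
    [∀ i, SigmaFinite (μ i)] (f : Fin n → α → ℝ≥0∞) (hf : ∀ i, Measurable (f i)) :
    ∫⁻ x, ∏ i, f i (x i) ∂(Measure.pi μ) = ∏ i, ∫⁻ a, f i a ∂(μ i) := by
  induction n with
  | zero => simp
  | succ n ih =>
    rw [← (measurePreserving_piFinSuccAbove μ 0).symm.lintegral_comp_emb
      (MeasurableEquiv.measurableEmbedding _)]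
    simp only [Fin.prod_univ_succ, MeasurableEquiv.piFinSuccAbove_symm_apply,
      Fin.insertNthEquiv_apply, Fin.insertNth_zero', Fin.cons_zero, Fin.cons_succ]
    rw [lintegral_prod_mul (g := fun y : Fin n → α => ∏ i, f i.succ (y i)) (hf 0).aemeasurable
      (Finset.measurable_fun_prod _ fun i _ => (hf _).comp (measurable_pi_apply i)).aemeasurable]
    rw [← ih _ _ fun i => hf i.succ]
    simp

theorem pi_fin_withDensity {α : Type*} [MeasurableSpace α] {n : ℕ} (μ : Fin n → Measure α)
    [∀ i, SigmaFinite (μ i)] (f : Fin n → α → ℝ≥0∞) (hf : ∀ i, Measurable (f i))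
    [∀ i, SigmaFinite ((μ i).withDensity (f i))] :
    Measure.pi (fun i => (μ i).withDensity (f i)) =
      (Measure.pi μ).withDensity fun x => ∏ i, f i (x i) := by
  refine Measure.pi_eq fun s hs => ?_
  rw [withDensity_apply _ (MeasurableSet.univ_pi hs),
    ← lintegral_indicator (MeasurableSet.univ_pi hs)]
  have : (Set.univ.pi s).indicator (fun x => ∏ i, f i (x i)) =
      fun x => ∏ i, (s i).indicator (f i) (x i) := by
    funext x
    by_cases h : x ∈ Set.univ.pi s
    · rw [Set.indicator_of_mem h]
      exact Finset.prod_congr rfl fun i _ => (Set.indicator_of_mem (h i trivial) _).symm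
    · rw [Set.indicator_of_notMem h]
      simp only [Set.mem_pi, Set.mem_univ, true_imp_iff, not_forall] at h
      obtain ⟨i, hi⟩ := h
      exact (Finset.prod_eq_zero (Finset.mem_univ i) (Set.indicator_of_notMem hi _)).symm
  rw [this, lintegral_pi_fin_prod μ _ fun i => (hf i).indicator (hs i)]
  refine Finset.prod_congr rfl fun i _ => ?_
  rw [lintegral_indicator (hs i), withDensity_apply _ (hs i)]

theorem lintegral_polar {E : Type*} [NormedAddCommGroup E] [NormedSpace ℝ E] [MeasurableSpace E]
    [BorelSpace E] [FiniteDimensional ℝ E] [Nontrivial E] (μ : Measure E) [μ.IsAddHaarMeasure]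
    {f : E → ℝ≥0∞} (hf : Measurable f) :
    ∫⁻ x, f x ∂μ = ∫⁻ r in Set.Ioi (0 : ℝ), ∫⁻ u : Metric.sphere (0 : E) 1,
      ENNReal.ofReal (r ^ (Module.finrank ℝ E - 1)) * f (r • (u : E)) ∂μ.toSphere := by
  have hm : Measurable fun z : Metric.sphere (0 : E) 1 × Set.Ioi (0 : ℝ) =>
      f (z.2.1 • (z.1 : E)) := hf.comp (by fun_prop)
  calc
    ∫⁻ x, f x ∂μ = ∫⁻ x : ({(0)}ᶜ : Set E), f x ∂(μ.comap (↑)) := by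
      rw [lintegral_subtype_comap (measurableSet_singleton _).compl f, restrict_compl_singleton]
    _ = ∫⁻ z, f (z.2.1 • (z.1 : E)) ∂μ.toSphere.prod (.volumeIoiPow (Module.finrank ℝ E - 1)) := by
      rw [← μ.measurePreserving_homeomorphUnitSphereProd.lintegral_comp_emb
        (Homeomorph.measurableEmbedding _)]
      refine lintegral_congr fun x => ?_
      congr 1
      have : ‖x.1‖ ≠ 0 := norm_ne_zero_iff.2 x.2
      simp [smul_smul, this]
    _ = _ := by
      rw [lintegral_prod_symm _ hm.aemeasurable, Measure.volumeIoiPow,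
        lintegral_withDensity_eq_lintegral_mul _ (by fun_prop)
          (Measurable.lintegral_prod_left' hm)]
      rw [← lintegral_subtype_comap measurableSet_Ioi]
      refine lintegral_congr fun r => ?_
      rw [lintegral_const_mul]
      · rfl
      · exact hf.comp (by fun_prop)

theorem lintegral_Ioi_sq (g : ℝ → ℝ≥0∞) :
    ∫⁻ r in Set.Ioi (0 : ℝ), ENNReal.ofReal (2 * r) * g (r ^ 2) = ∫⁻ z in Set.Ioi (0 : ℝ), g z := by
  have him : (fun r : ℝ => r ^ 2) '' Set.Ioi 0 = Set.Ioi 0 := by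
    ext z
    constructor
    · rintro ⟨r, hr, rfl⟩
      exact pow_pos (Set.mem_Ioi.1 hr) 2
    · intro hz
      exact ⟨√z, Real.sqrt_pos.2 hz, Real.sq_sqrt (le_of_lt hz)⟩
  conv_rhs => rw [← him]
  rw [lintegral_image_eq_lintegral_abs_deriv_mul measurableSet_Ioi (f' := fun r => 2 * r)]
  · refine setLIntegral_congr_fun measurableSet_Ioi fun r hr => ?_
    rw [abs_of_pos (mul_pos two_pos hr)]
  · intro x _
    simpa using (hasDerivAt_pow 2 x).hasDerivWithinAt
  · intro a ha b hb h
    exact (pow_left_inj₀ (le_of_lt ha) (le_of_lt hb) two_ne_zero).1 h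

theorem lintegral_Ioi_pow_mul_exp_neg (m : ℕ) :
    ∫⁻ z in Set.Ioi (0 : ℝ), ENNReal.ofReal (z ^ m * Real.exp (-z)) =
      ENNReal.ofReal (m.factorial : ℝ) := by
  have hm : (0 : ℝ) < m + 1 := by positivity
  have h := Real.Gamma_eq_integral hm
  have hi := Real.GammaIntegral_convergent hm
  rw [Real.Gamma_nat_eq_factorial] at h
  have e : ∀ z : ℝ, Real.exp (-z) * z ^ ((m : ℝ) + 1 - 1) = z ^ m * Real.exp (-z) := fun z => by
    rw [add_sub_cancel_right, Real.rpow_natCast, mul_comm]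
  simp only [e] at h hi
  rw [h, ofReal_integral_eq_lintegral_ofReal hi]
  filter_upwards [ae_restrict_mem measurableSet_Ioi] with z hz
  exact mul_nonneg (pow_nonneg (le_of_lt hz) _) (Real.exp_pos _).le

/-- A nonzero power series has no zeros in some punctured neighbourhood of `0`, whereas the positive
reals accumulate there. -/
theorem eq_zero_of_tsum_mul_pow_eq_zero {b : ℕ → ℝ} (hb : ∀ s, Summable fun k => b k * s ^ k)
    (h : ∀ s, 0 < s → ∑' k, b k * s ^ k = 0) : b = 0 := by
  let p : FormalMultilinearSeries ℝ ℝ ℝ := FormalMultilinearSeries.ofScalars ℝ b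
  let F : ℝ → ℝ := fun s => ∑' k, b k * s ^ k
  have hF : HasFPowerSeriesAt F p 0 := by
    rw [hasFPowerSeriesAt_iff]
    refine Filter.Eventually.of_forall fun z => ?_
    simpa [p, F, mul_comm, FormalMultilinearSeries.coeff_ofScalars] using (hb z).hasSum
  have hp : p = 0 := by
    by_contra hp
    have h0 := HasFPowerSeriesAt.locally_ne_zero hF hp
    have h1 : ∀ᶠ z in nhdsWithin (0 : ℝ) (Set.Ioi 0), F z ≠ 0 :=
      h0.filter_mono (nhdsWithin_mono _ fun z (hz : 0 < z) => ne_of_gt hz)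
    obtain ⟨z, hz, hz'⟩ := (h1.and self_mem_nhdsWithin).exists
    exact hz (h z hz')
  funext k
  have := FormalMultilinearSeries.coeff_ofScalars (𝕜 := ℝ) (p := b) (n := k)
  rw [← this]
  change p.coeff k = 0
  rw [hp]
  rfl

/-- Coefficients of a convergent power series with coefficients in `ℝ≥0∞` are determined by its
values at positive reals. -/
theorem eq_of_tsum_mul_pow_eq {B C : ℕ → ℝ≥0∞}
    (h : ∀ s : ℝ, 0 < s → ∑' k, B k * ENNReal.ofReal (s ^ k) = ∑' k, C k * ENNReal.ofReal (s ^ k))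
    (hfin : ∀ s : ℝ, 0 < s → ∑' k, C k * ENNReal.ofReal (s ^ k) ≠ ∞) : B = C := by
  -- Transfer to real series: the value at `s = 1` makes each coefficient finite, and the value at
  -- `|s| + 1` dominates the series at an arbitrary real `s`.
  have aux : ∀ D : ℕ → ℝ≥0∞, (∀ s : ℝ, 0 < s → ∑' k, D k * ENNReal.ofReal (s ^ k) ≠ ∞) →
      (∀ k, D k ≠ ∞) ∧ (∀ s : ℝ, Summable fun k => (D k).toReal * s ^ k) ∧
      ∀ s : ℝ, 0 < s → ∑' k, (D k).toReal * s ^ k =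
        (∑' k, D k * ENNReal.ofReal (s ^ k)).toReal := by
    intro D hD
    have e : ∀ s : ℝ, 0 < s → ∀ k, (D k * ENNReal.ofReal (s ^ k)).toReal = (D k).toReal * s ^ k :=
      fun s hs k => by rw [ENNReal.toReal_mul, ENNReal.toReal_ofReal (by positivity)]
    have hs : ∀ s : ℝ, 0 < s → Summable fun k => (D k).toReal * s ^ k := fun s hs => by
      simpa only [e s hs] using ENNReal.summable_toReal (hD s hs)
    refine ⟨fun k => ?_, fun s => ?_, fun s hs => ?_⟩
    · have := ENNReal.ne_top_of_tsum_ne_top (hD 1 one_pos) k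
      simpa using this
    · refine Summable.of_norm_bounded (hs (|s| + 1) (by positivity)) fun k => ?_
      rw [norm_mul, Real.norm_of_nonneg ENNReal.toReal_nonneg, norm_pow, Real.norm_eq_abs]
      gcongr
      linarith
    · rw [ENNReal.tsum_toReal_eq fun k => ENNReal.ne_top_of_tsum_ne_top (hD s hs) k]
      simp only [e s hs]
  obtain ⟨hB, hB', hB''⟩ := aux B fun s hs => h s hs ▸ hfin s hs
  obtain ⟨hC, hC', hC''⟩ := aux C hfin
  have := eq_zero_of_tsum_mul_pow_eq_zero (b := fun k => (B k).toReal - (C k).toReal)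
    (fun s => by simpa only [sub_mul] using (hB' s).sub (hC' s))
    (fun s hs => by
      simp only [sub_mul]
      rw [(hB' s).tsum_sub (hC' s), hB'' s hs, hC'' s hs, h s hs, sub_self])
  funext k
  have hk := congrFun this k
  exact (ENNReal.toReal_eq_toReal_iff' (hB k) (hC k)).1 (sub_eq_zero.1 hk)

/-! ### Exponential integrals over the sphere -/

/-- `hyp n t = ₀F₁(; n; t) = ∑ (n-1)! / (k! (n+k-1)!) t ^ k`. -/
noncomputable def hyp (n : ℕ) (t : ℝ) : ℝ :=
  ∑' k : ℕ, ((n - 1).factorial : ℝ) / (k.factorial * (k + (n - 1)).factorial) * t ^ k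

theorem summable_hyp (n : ℕ) (t : ℝ) :
    Summable fun k : ℕ => ((n - 1).factorial : ℝ) / (k.factorial * (k + (n - 1)).factorial) * t ^ k := by
  refine Summable.of_norm_bounded (g := fun k : ℕ => ‖((n - 1).factorial : ℝ) * (t ^ k / k.factorial)‖)
    ((Real.summable_pow_div_factorial t).mul_left _).norm fun k => ?_
  have h1 : (1 : ℝ) ≤ (k + (n - 1)).factorial := by exact_mod_cast Nat.factorial_pos _
  have h0 : (0 : ℝ) < k.factorial := by positivity
  rw [norm_mul, norm_mul, norm_div, norm_div, norm_mul, norm_natCast, norm_natCast, norm_natCast]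
  rw [div_mul_eq_mul_div, ← mul_div_assoc]
  gcongr
  nlinarith

theorem hyp_zero {n : ℕ} : hyp n 0 = 1 := by
  rw [hyp, tsum_eq_single 0]
  · simp [Nat.factorial_ne_zero]
  · intro k hk
    simp [hk]

section Sphere
variable {E : Type*} [NormedAddCommGroup E] [InnerProductSpace ℝ E] [MeasurableSpace E]
  [BorelSpace E] [FiniteDimensional ℝ E]

/-- Complete the square, `2⟪a, x⟫ - ‖x‖ ^ 2 = ‖a‖ ^ 2 - ‖x - a‖ ^ 2`, and translate. -/
theorem lintegral_exp_inner_sub_norm_sq (a : E) :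
    ∫⁻ x, ENNReal.ofReal (Real.exp (2 * ⟪a, x⟫ - ‖x‖ ^ 2)) ∂(volume : Measure E) =
      ENNReal.ofReal (Real.pi ^ ((Module.finrank ℝ E : ℝ) / 2) * Real.exp (‖a‖ ^ 2)) := by
  have h1 : ∀ x : E, ENNReal.ofReal (Real.exp (2 * ⟪a, x⟫ - ‖x‖ ^ 2)) =
      ENNReal.ofReal (Real.exp (‖a‖ ^ 2)) * ENNReal.ofReal (Real.exp (-1 * ‖x - a‖ ^ 2)) := by
    intro x
    rw [← ENNReal.ofReal_mul (Real.exp_pos _).le, ← Real.exp_add, norm_sub_sq_real,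
      real_inner_comm]
    congr 2
    ring
  simp only [h1]
  have hg := GaussianFourier.integral_rexp_neg_mul_sq_norm (V := E) one_pos
  rw [lintegral_const_mul _ (by fun_prop),
    lintegral_sub_right_eq_self (fun x : E => ENNReal.ofReal (Real.exp (-1 * ‖x‖ ^ 2))) a,
    ← ofReal_integral_eq_lintegral_ofReal _ (Filter.Eventually.of_forall fun x => (Real.exp_pos _).le),
    hg, ← ENNReal.ofReal_mul (Real.exp_pos _).le, div_one, mul_comm]
  -- The Bochner integral of a non-integrable function is `0` by convention, so the positive
  -- Gaussian value proves integrability.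
  by_contra hni
  have := integral_undef hni
  rw [hg] at this
  have : (0 : ℝ) < (Real.pi / 1) ^ ((Module.finrank ℝ E : ℝ) / 2) := by positivity
  linarith

theorem lintegral_cosh_inner_mul_exp_neg_norm_sq (a : E) :
    ∫⁻ x, ENNReal.ofReal (Real.cosh (2 * ⟪a, x⟫) * Real.exp (-‖x‖ ^ 2)) ∂(volume : Measure E) =
      ENNReal.ofReal (Real.pi ^ ((Module.finrank ℝ E : ℝ) / 2) * Real.exp (‖a‖ ^ 2)) := by
  have h1 : ∀ x : E, ENNReal.ofReal (Real.cosh (2 * ⟪a, x⟫) * Real.exp (-‖x‖ ^ 2)) =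
      ENNReal.ofReal (1 / 2) * (ENNReal.ofReal (Real.exp (2 * ⟪a, x⟫ - ‖x‖ ^ 2)) +
        ENNReal.ofReal (Real.exp (2 * ⟪-a, x⟫ - ‖x‖ ^ 2))) := by
    intro x
    rw [← ENNReal.ofReal_add (Real.exp_pos _).le (Real.exp_pos _).le,
      ← ENNReal.ofReal_mul (by norm_num), Real.cosh_eq, sub_eq_add_neg, sub_eq_add_neg,
      Real.exp_add, Real.exp_add, inner_neg_left, mul_neg]
    congr 1
    ring
  simp only [h1]
  rw [lintegral_const_mul _ (by fun_prop), lintegral_add_left (by fun_prop),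
    lintegral_exp_inner_sub_norm_sq, lintegral_exp_inner_sub_norm_sq, norm_neg,
    ← ENNReal.ofReal_add (by positivity) (by positivity), ← ENNReal.ofReal_mul (by norm_num)]
  congr 1
  ring

/-- The cone over `-s` is the negative of the cone over `s`, and volume is invariant under negation.
-/
theorem map_neg_toSphere :
    ((volume : Measure E).toSphere).map (fun u => -u) = (volume : Measure E).toSphere := by
  have hm : Measurable fun u : Metric.sphere (0 : E) 1 => -u := continuous_neg.measurable
  ext s hs
  rw [Measure.map_apply hm hs, Measure.toSphere_apply' _ hs, Measure.toSphere_apply' _ (hm hs)]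
  congr 1
  rw [← Measure.measure_preimage_neg]
  congr 1
  ext x
  simp only [Set.mem_preimage, Set.mem_smul, Set.mem_image]
  constructor
  · rintro ⟨r, hr, _, ⟨u, hu, rfl⟩, h⟩
    exact ⟨r, hr, _, ⟨-u, hu, rfl⟩, by simp [h]⟩
  · rintro ⟨r, hr, _, ⟨u, hu, rfl⟩, rfl⟩
    exact ⟨r, hr, _, ⟨-u, by simpa using hu, rfl⟩, by simp⟩

/-- Symmetrization under `u ↦ -u` removes the odd part. The series of `cosh` has nonnegative terms,
so sums and integrals can later be exchanged without any integrability condition. -/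
theorem lintegral_toSphere_exp_eq_cosh (a : E) :
    ∫⁻ u : Metric.sphere (0 : E) 1, ENNReal.ofReal (Real.exp (2 * ⟪a, u⟫))
        ∂(volume : Measure E).toSphere =
      ∫⁻ u : Metric.sphere (0 : E) 1, ENNReal.ofReal (Real.cosh (2 * ⟪a, u⟫))
        ∂(volume : Measure E).toSphere := by
  have hm : Measurable fun u : Metric.sphere (0 : E) 1 => -u := continuous_neg.measurable
  have h1 : ∀ u : Metric.sphere (0 : E) 1, ENNReal.ofReal (Real.cosh (2 * ⟪a, u⟫)) =
      ENNReal.ofReal (1 / 2) * (ENNReal.ofReal (Real.exp (2 * ⟪a, u⟫)) +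
        ENNReal.ofReal (Real.exp (2 * ⟪a, (-u : Metric.sphere (0 : E) 1)⟫))) := by
    intro u
    rw [← ENNReal.ofReal_add (Real.exp_pos _).le (Real.exp_pos _).le,
      ← ENNReal.ofReal_mul (by norm_num), Real.cosh_eq]
    congr 1
    simp
    ring
  have h2 : ∫⁻ u : Metric.sphere (0 : E) 1,
      ENNReal.ofReal (Real.exp (2 * ⟪a, (-u : Metric.sphere (0 : E) 1)⟫))
        ∂(volume : Measure E).toSphere =
      ∫⁻ u : Metric.sphere (0 : E) 1, ENNReal.ofReal (Real.exp (2 * ⟪a, u⟫))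
        ∂(volume : Measure E).toSphere := by
    conv_rhs => rw [← map_neg_toSphere]
    rw [lintegral_map (by fun_prop) hm]
  simp only [h1]
  rw [lintegral_const_mul _ (by fun_prop), lintegral_add_left (by fun_prop), h2, ← two_mul,
    ← mul_assoc, show (2 : ℝ≥0∞) = ENNReal.ofReal 2 by simp,
    ← ENNReal.ofReal_mul (by norm_num)]
  norm_num

theorem ofReal_cosh_eq_tsum (x : ℝ) :
    ENNReal.ofReal (Real.cosh x) = ∑' k : ℕ, ENNReal.ofReal (x ^ (2 * k) / (2 * k).factorial) := by
  rw [Real.cosh_eq_tsum, ENNReal.ofReal_tsum_of_nonneg _ (Real.hasSum_cosh x).summable]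
  intro k
  rw [pow_mul]
  positivity

/-- The Gaussian integral of `cosh (2⟪t • a, x⟫)` is known in closed form. In polar coordinates it
is a power series in `t ^ 2` whose coefficients are the even spherical moments times Gamma
integrals, so comparing coefficients determines every moment. Summing the moments gives `hyp`. -/
theorem lintegral_toSphere_exp_inner {n : ℕ} (hn : 1 ≤ n) (hE : Module.finrank ℝ E = 2 * n) (a : E) :
    ∫⁻ u : Metric.sphere (0 : E) 1, ENNReal.ofReal (Real.exp (2 * ⟪a, u⟫))
        ∂(volume : Measure E).toSphere =
      ENNReal.ofReal (2 * Real.pi ^ n / (n - 1).factorial * hyp n (‖a‖ ^ 2)) := by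
  have : Nontrivial E := Module.nontrivial_of_finrank_pos (R := ℝ) (by omega)
  set σ := (volume : Measure E).toSphere
  let m : ℕ → ℝ≥0∞ := fun k =>
    ∫⁻ u : Metric.sphere (0 : E) 1, ENNReal.ofReal ((2 * ⟪a, u⟫) ^ (2 * k) / (2 * k).factorial) ∂σ
  have hcosh : ∀ t : ℝ, ∫⁻ u : Metric.sphere (0 : E) 1,
      ENNReal.ofReal (Real.cosh (2 * ⟪t • a, u⟫)) ∂σ = ∑' k, ENNReal.ofReal (t ^ (2 * k)) * m k := by
    intro t
    simp only [ofReal_cosh_eq_tsum]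
    rw [lintegral_tsum fun k => by fun_prop]
    refine tsum_congr fun k => ?_
    rw [← lintegral_const_mul _ (by fun_prop)]
    refine lintegral_congr fun u => ?_
    rw [← ENNReal.ofReal_mul (by rw [pow_mul]; positivity), real_inner_smul_left]
    congr 1
    ring
  -- Radial moments: the substitution `z = r ^ 2` turns them into Gamma integrals.
  have hrad : ∀ k : ℕ, ∫⁻ r in Set.Ioi (0 : ℝ),
      ENNReal.ofReal (r ^ (2 * n - 1) * r ^ (2 * k) * Real.exp (-r ^ 2)) =
        ENNReal.ofReal ((k + (n - 1)).factorial / 2) := by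
    intro k
    have h2 := lintegral_Ioi_sq fun z => ENNReal.ofReal (z ^ (k + (n - 1)) * Real.exp (-z) / 2)
    have h3 : ∫⁻ z in Set.Ioi (0 : ℝ), ENNReal.ofReal (z ^ (k + (n - 1)) * Real.exp (-z) / 2) =
        ENNReal.ofReal ((k + (n - 1)).factorial / 2) := by
      have : ∀ z : ℝ, ENNReal.ofReal (z ^ (k + (n - 1)) * Real.exp (-z) / 2) =
          ENNReal.ofReal (1 / 2) * ENNReal.ofReal (z ^ (k + (n - 1)) * Real.exp (-z)) := fun z => by
        rw [← ENNReal.ofReal_mul (by norm_num)]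
        congr 1
        ring
      simp only [this]
      rw [lintegral_const_mul _ (by fun_prop), lintegral_Ioi_pow_mul_exp_neg,
        ← ENNReal.ofReal_mul (by norm_num)]
      congr 1
      ring
    rw [← h3, ← h2]
    refine setLIntegral_congr_fun measurableSet_Ioi fun r hr => ?_
    rw [← ENNReal.ofReal_mul (mul_nonneg zero_le_two (le_of_lt hr))]
    congr 1
    obtain ⟨j, rfl⟩ : ∃ j, n = j + 1 := ⟨n - 1, by omega⟩
    rw [show 2 * (j + 1) - 1 = 2 * j + 1 by omega, show j + 1 - 1 = j by omega]
    ring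
  have key : ∀ t : ℝ, ∑' k, ENNReal.ofReal (t ^ (2 * k)) *
        (m k * ENNReal.ofReal ((k + (n - 1)).factorial / 2)) =
      ENNReal.ofReal (Real.pi ^ n * Real.exp (t ^ 2 * ‖a‖ ^ 2)) := by
    intro t
    have h := lintegral_cosh_inner_mul_exp_neg_norm_sq (t • a)
    rw [hE, norm_smul, mul_pow, Real.norm_eq_abs, sq_abs, lintegral_polar volume (by fun_prop), hE,
      show (((2 * n : ℕ) : ℝ) / 2) = n by push_cast; ring, Real.rpow_natCast] at h
    rw [← h]
    have hr : ∀ r ∈ Set.Ioi (0 : ℝ), ∫⁻ u : Metric.sphere (0 : E) 1,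
        ENNReal.ofReal (r ^ (2 * n - 1)) * ENNReal.ofReal (Real.cosh (2 * ⟪t • a, r • (u : E)⟫) *
          Real.exp (-‖r • (u : E)‖ ^ 2)) ∂σ =
        ∑' k, ENNReal.ofReal (t ^ (2 * k)) * m k *
          ENNReal.ofReal (r ^ (2 * n - 1) * r ^ (2 * k) * Real.exp (-r ^ 2)) := by
      intro r hr
      have hr0 : (0 : ℝ) < r := hr
      have e1 : ∀ u : Metric.sphere (0 : E) 1, ENNReal.ofReal (r ^ (2 * n - 1)) *
          ENNReal.ofReal (Real.cosh (2 * ⟪t • a, r • (u : E)⟫) * Real.exp (-‖r • (u : E)‖ ^ 2)) =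
          ENNReal.ofReal (r ^ (2 * n - 1) * Real.exp (-r ^ 2)) *
            ENNReal.ofReal (Real.cosh (2 * ⟪(r * t) • a, u⟫)) := by
        intro u
        have hu : ‖(u : E)‖ = 1 := norm_eq_of_mem_sphere u
        rw [← ENNReal.ofReal_mul (by positivity), ← ENNReal.ofReal_mul (by positivity), norm_smul, hu,
          mul_one, Real.norm_eq_abs, sq_abs, real_inner_smul_left, real_inner_smul_left,
          real_inner_smul_right, show 2 * (t * (r * ⟪a, (u : E)⟫)) = 2 * (r * t * ⟪a, (u : E)⟫) by ring]
        congr 1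
        ring
      simp only [e1]
      rw [lintegral_const_mul _ (by fun_prop), hcosh, ← ENNReal.tsum_mul_left]
      refine tsum_congr fun k => ?_
      have ht : 0 ≤ t ^ (2 * k) := by rw [pow_mul]; positivity
      rw [mul_right_comm (ENNReal.ofReal (t ^ (2 * k))), ← mul_assoc,
        ← ENNReal.ofReal_mul (by positivity), ← ENNReal.ofReal_mul ht]
      congr 2
      ring
    rw [setLIntegral_congr_fun measurableSet_Ioi hr, lintegral_tsum fun k => by fun_prop]
    refine tsum_congr fun k => ?_
    rw [lintegral_const_mul _ (by fun_prop), hrad, mul_assoc]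
  let C : ℕ → ℝ≥0∞ := fun k => ENNReal.ofReal (Real.pi ^ n * ((‖a‖ ^ 2) ^ k / k.factorial))
  have hC : ∀ s : ℝ, 0 < s → ∑' k, C k * ENNReal.ofReal (s ^ k) =
      ENNReal.ofReal (Real.pi ^ n * Real.exp (s * ‖a‖ ^ 2)) := by
    intro s hs
    have := (NormedSpace.expSeries_div_hasSum_exp (𝔸 := ℝ) (s * ‖a‖ ^ 2)).mul_left (Real.pi ^ n)
    rw [← Real.exp_eq_exp_ℝ] at this
    rw [← this.tsum_eq, ENNReal.ofReal_tsum_of_nonneg (fun k => by positivity) this.summable]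
    refine tsum_congr fun k => ?_
    rw [← ENNReal.ofReal_mul (by positivity), mul_pow]
    congr 1
    ring
  -- Take `t = √s`, so that `t ^ (2 * k)` becomes `s ^ k`.
  have hmC := eq_of_tsum_mul_pow_eq
    (B := fun k => m k * ENNReal.ofReal ((k + (n - 1)).factorial / 2)) (C := C)
    (fun s hs => by
      rw [hC s hs]
      have := key √s
      rw [Real.sq_sqrt hs.le] at this
      rw [← this]
      refine tsum_congr fun k => ?_
      rw [pow_mul, Real.sq_sqrt hs.le, mul_comm])
    (fun s hs => by rw [hC s hs]; exact ENNReal.ofReal_ne_top)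
  have hm : ∀ k, m k = ENNReal.ofReal (2 * Real.pi ^ n / (n - 1).factorial *
      (((n - 1).factorial : ℝ) / (k.factorial * (k + (n - 1)).factorial) * (‖a‖ ^ 2) ^ k)) := by
    intro k
    have h := congrFun hmC k
    simp only [C] at h
    have hf : (0 : ℝ) < (k + (n - 1)).factorial / 2 := by positivity
    rw [← ENNReal.mul_left_inj (c := ENNReal.ofReal ((k + (n - 1)).factorial / 2))
      (by simpa using hf) ENNReal.ofReal_ne_top, h, ← ENNReal.ofReal_mul (by positivity)]
    congr 1
    have : ((n - 1).factorial : ℝ) ≠ 0 := by positivity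
    field_simp
  rw [lintegral_toSphere_exp_eq_cosh]
  have := hcosh 1
  simp only [one_smul, one_pow, ENNReal.ofReal_one, one_mul] at this
  rw [this, hyp, ← tsum_mul_left, ENNReal.ofReal_tsum_of_nonneg (fun k => by positivity)
    ((summable_hyp n _).mul_left _)]
  exact tsum_congr hm

end Sphere

/-! ### The dependence-testing bound -/

theorem lintegral_pi_eval {α : Type*} [MeasurableSpace α] (P : Measure α) [IsProbabilityMeasure P]
    {M : ℕ} (j : Fin M) {f : α → ℝ≥0∞} (hf : Measurable f) :
    ∫⁻ c : Fin M → α, f (c j) ∂(Measure.pi fun _ => P) = ∫⁻ x, f x ∂P :=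
  (measurePreserving_eval (fun _ : Fin M => P) j).lintegral_comp hf

theorem lintegral_pi_eval_mul_eval {α : Type*} [MeasurableSpace α] (P : Measure α)
    [IsProbabilityMeasure P] {M : ℕ} {j k : Fin M} (hjk : j ≠ k) {f g : α → ℝ≥0∞}
    (hf : Measurable f) (hg : Measurable g) :
    ∫⁻ c : Fin M → α, f (c j) * g (c k) ∂(Measure.pi fun _ => P) =
      (∫⁻ x, f x ∂P) * ∫⁻ x, g x ∂P := by
  have hi : iIndepFun (fun (i : Fin M) (c : Fin M → α) => c i) (Measure.pi fun _ => P) :=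
    iIndepFun_pi (X := fun _ x => x) fun i => aemeasurable_id
  have hi' := (hi.indepFun hjk).comp hf hg
  have := lintegral_mul_eq_lintegral_mul_lintegral_of_indepFun
    (hf.comp (measurable_pi_apply j)) (hg.comp (measurable_pi_apply k)) hi'
  rw [← lintegral_pi_eval P j hf, ← lintegral_pi_eval P k hg]
  exact this

/-- The decoder that returns the first message accepted by the test `A`. -/
noncomputable def firstMatch {β : Type*} {M : ℕ} [NeZero M] (A : Fin M → Set β) (y : β) : Fin M :=
  open scoped Classical in
  if h : ∃ j, y ∈ A j then Fin.find _ h else 0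

theorem measurable_firstMatch {β : Type*} [MeasurableSpace β] {M : ℕ} [NeZero M]
    {A : Fin M → Set β} (hA : ∀ j, MeasurableSet (A j)) : Measurable (firstMatch A) := by
  classical
  let F : (Fin M → Prop) → Fin M := fun b => if h : ∃ j, b j then Fin.find _ h else 0
  have hF : Measurable F := measurable_of_countable F
  have hA' : Measurable fun y : β => fun j => y ∈ A j :=
    measurable_pi_lambda _ fun j => measurable_mem.2 (hA j)
  convert hF.comp hA' using 1
  funext y
  simp only [firstMatch, F, Function.comp_apply]

/-- An error is either a missed detection or a false alarm of an earlier message. Later messages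
cannot cause one, which is what halves `M - 1` in the bound. -/
theorem firstMatch_ne {β : Type*} {M : ℕ} [NeZero M] {A : Fin M → Set β} {y : β} {j : Fin M}
    (h : firstMatch A y ≠ j) : y ∉ A j ∨ ∃ k < j, y ∈ A k := by
  classical
  by_contra! hc
  apply h
  have hex : ∃ j, y ∈ A j := ⟨j, hc.1⟩
  rw [firstMatch, dif_pos hex]
  refine le_antisymm (Fin.find_le_of_pos _ hc.1) ?_
  by_contra! hlt
  exact hc.2 _ hlt (Fin.find_spec hex)

theorem sum_fin_val_eq (M : ℕ) (hM : 1 ≤ M) :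
    ∑ j : Fin M, ((Finset.Iio j).card : ℝ≥0∞) = M * ENNReal.ofReal (((M : ℝ) - 1) / 2) := by
  simp only [Fin.card_Iio]
  have h : ∑ j : Fin M, ((j : ℕ) : ℝ) = M * (((M : ℝ) - 1) / 2) := by
    rw [Fin.sum_univ_eq_sum_range (fun i => (i : ℝ)) M]
    have := Finset.sum_range_id_mul_two M
    have h2 : (∑ i ∈ Finset.range M, (i : ℝ)) * 2 = M * ((M : ℝ) - 1) := by
      have := congrArg (Nat.cast (R := ℝ)) this
      push_cast [Nat.cast_sub hM] at this
      exact this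
    linarith
  have e : ∀ j : Fin M, ((j : ℕ) : ℝ≥0∞) = ENNReal.ofReal ((j : ℕ) : ℝ) := fun j => by simp
  simp only [e]
  rw [← ENNReal.ofReal_sum_of_nonneg fun j _ => Nat.cast_nonneg _, h,
    ENNReal.ofReal_mul (Nat.cast_nonneg _)]
  simp

/-- Dependence-testing bound: for transition densities `p` and an input law `P` there is a code
with `M` codewords whose average error probability is at most
`∫∫ min (p x y) ((M - 1) / 2 * q y)`, where `q` is the output density. -/
theorem dependence_testing_bound {α β : Type*} [MeasurableSpace α] [MeasurableSpace β]
    (P : Measure α) [IsProbabilityMeasure P] (ν : Measure β) [SigmaFinite ν] (p : α → β → ℝ≥0∞)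
    (hp : Measurable (Function.uncurry p)) (M : ℕ) [NeZero M] :
    ∃ (c : Fin M → α) (g : β → Fin M), Measurable g ∧
      ∑ j, ∫⁻ y in {y | g y ≠ j}, p (c j) y ∂ν ≤
        M * ∫⁻ x, ∫⁻ y, min (p x y)
          (ENNReal.ofReal (((M : ℝ) - 1) / 2) * ∫⁻ x', p x' y ∂P) ∂ν ∂P := by
  classical
  set γ := ENNReal.ofReal (((M : ℝ) - 1) / 2)
  set q : β → ℝ≥0∞ := fun y => ∫⁻ x', p x' y ∂P
  have hq : Measurable q := Measurable.lintegral_prod_left' hp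
  have hp1 : ∀ x, Measurable (p x) := fun x => hp.comp measurable_prodMk_left
  have hp2 : ∀ y, Measurable fun x => p x y := fun y => hp.comp measurable_prodMk_right
  let S : Set (α × β) := {z | γ * q z.2 < p z.1 z.2}
  have hS : MeasurableSet S :=
    measurableSet_lt ((hq.comp measurable_snd).const_mul γ) hp
  let T : α → β → ℝ≥0∞ := fun x y => S.indicator 1 (x, y)
  have hT : Measurable (Function.uncurry T) := measurable_one.indicator hS
  have hT2 : ∀ y, Measurable fun x => T x y := fun y => hT.comp measurable_prodMk_right
  let e : α → β → ℝ≥0∞ := fun x y => Sᶜ.indicator (Function.uncurry p) (x, y)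
  have he : Measurable (Function.uncurry e) := hp.indicator hS.compl
  have he2 : ∀ y, Measurable fun x => e x y := fun y => he.comp measurable_prodMk_right
  -- Off `S` a missed detection costs `p`; on `S` false alarms cost `γ * q`. The threshold `γ` makes
  -- the total cost the pointwise minimum.
  have hmin : ∀ x y, min (p x y) (γ * q y) = e x y + γ * (q y * T x y) := by
    intro x y
    by_cases h : γ * q y < p x y
    · have hm : (x, y) ∈ S := h
      simp [e, T, hm, min_eq_right h.le]
    · have hm : (x, y) ∉ S := h
      simp [e, T, hm, min_eq_left (not_lt.1 h)]
  let A : (Fin M → α) → Fin M → Set β := fun c j => {y | γ * q y < p (c j) y}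
  have hA : ∀ c j, MeasurableSet (A c j) := fun c j =>
    measurableSet_lt (hq.const_mul γ) (hp1 _)
  -- Union bound on the error integrand of message `j`.
  let B : (Fin M → α) → β → Fin M → ℝ≥0∞ := fun c y j =>
    e (c j) y + ∑ k ∈ Finset.Iio j, p (c j) y * T (c k) y
  have hB : ∀ j, Measurable fun z : (Fin M → α) × β => B z.1 z.2 j := by
    intro j
    have h : ∀ j : Fin M, Measurable fun z : (Fin M → α) × β => (z.1 j, z.2) := fun j => by
      fun_prop
    refine (he.comp (h j)).add (Finset.measurable_fun_sum _ fun k _ => ?_)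
    exact (hp.comp (h j)).mul (hT.comp (h k))
  have herr : ∀ c j, ∫⁻ y in {y | firstMatch (A c) y ≠ j}, p (c j) y ∂ν ≤ ∫⁻ y, B c y j ∂ν := by
    intro c j
    have hms : MeasurableSet {y | firstMatch (A c) y ≠ j} :=
      (measurable_firstMatch (hA c)) (measurableSet_singleton j).compl
    rw [← lintegral_indicator hms]
    refine lintegral_mono fun y => ?_
    by_cases hy : firstMatch (A c) y ≠ j
    · rw [Set.indicator_of_mem (by exact hy)]
      rcases firstMatch_ne hy with h | ⟨k, hk, h⟩
      · have hm : (c j, y) ∉ S := h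
        refine le_trans (le_of_eq ?_) le_self_add
        simp [e, hm]
      · have hm : (c k, y) ∈ S := h
        refine le_trans ?_ le_add_self
        refine le_trans (le_of_eq ?_)
          (Finset.single_le_sum (f := fun k => p (c j) y * T (c k) y) (fun _ _ => zero_le)
            (Finset.mem_Iio.2 hk))
        simp [T, hm]
    · rw [Set.indicator_of_notMem (by exact hy)]
      exact zero_le
  -- Some codebook does no worse than the average over independent codewords.
  obtain ⟨c, hc⟩ := exists_le_lintegral (μ := Measure.pi fun _ : Fin M => P)
    (f := fun c => ∑ j, ∫⁻ y, B c y j ∂ν)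
    (Finset.measurable_fun_sum _ fun j _ => Measurable.lintegral_prod_right' (hB j)).aemeasurable
  refine ⟨c, firstMatch (A c), measurable_firstMatch (hA c),
    (Finset.sum_le_sum fun j _ => herr c j).trans (hc.trans (le_of_eq ?_))⟩
  -- For `k < j` the codewords `c j` and `c k` are independent, so the factor `p (c j) y` averages
  -- to `q y`.
  have hBj : ∀ j y, ∫⁻ c : Fin M → α, B c y j ∂(Measure.pi fun _ => P) =
      ∫⁻ x, e x y ∂P + (Finset.Iio j).card * (q y * ∫⁻ x, T x y ∂P) := by
    intro j y
    have hm : ∀ k, Measurable fun c : Fin M → α => p (c j) y * T (c k) y := fun k =>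
      ((hp2 y).comp (measurable_pi_apply j)).mul ((hT2 y).comp (measurable_pi_apply k))
    simp only [B]
    rw [lintegral_add_left (f := fun c : Fin M → α => e (c j) y)
        ((he2 y).comp (measurable_pi_apply j)),
      lintegral_pi_eval P j (he2 y), lintegral_finsetSum _ fun k _ => hm k]
    congr 1
    rw [Finset.sum_congr rfl fun k hk => lintegral_pi_eval_mul_eval P
      (ne_of_gt (Finset.mem_Iio.1 hk)) (hp2 y) (hT2 y)]
    simp [q]
  have heI : Measurable fun y => ∫⁻ x, e x y ∂P := Measurable.lintegral_prod_left' he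
  have hTI : Measurable fun y => ∫⁻ x, T x y ∂P := Measurable.lintegral_prod_left' hT
  have hqT : Measurable fun y => q y * ∫⁻ x, T x y ∂P := hq.mul hTI
  rw [lintegral_finsetSum _ fun j _ => Measurable.lintegral_prod_right' (hB j)]
  have hswap : ∀ j, ∫⁻ c : Fin M → α, ∫⁻ y, B c y j ∂ν ∂(Measure.pi fun _ => P) =
      ∫⁻ y, ∫⁻ x, e x y ∂P ∂ν + (Finset.Iio j).card * ∫⁻ y, q y * ∫⁻ x, T x y ∂P ∂ν := by
    intro j
    rw [lintegral_lintegral_swap (hB j).aemeasurable]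
    simp only [hBj]
    rw [lintegral_add_left heI, lintegral_const_mul _ hqT]
  simp only [hswap]
  -- Message `j` has `j` predecessors; their mean number is `(M - 1) / 2`, which is `γ`.
  rw [Finset.sum_add_distrib, ← Finset.sum_mul,
    sum_fin_val_eq M (Nat.one_le_iff_ne_zero.2 (NeZero.ne M))]
  change _ = (M : ℝ≥0∞) * ∫⁻ x, ∫⁻ y, min (p x y) (γ * q y) ∂ν ∂P
  simp only [hmin]
  rw [lintegral_lintegral_swap (f := fun x y => e x y + γ * (q y * T x y))
    (he.add (((hq.comp measurable_snd).mul hT).const_mul γ)).aemeasurable]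
  have hx : ∀ y, ∫⁻ x, (e x y + γ * (q y * T x y)) ∂P =
      ∫⁻ x, e x y ∂P + γ * (q y * ∫⁻ x, T x y ∂P) := by
    intro y
    rw [lintegral_add_left (he2 y), lintegral_const_mul _ ((hT2 y).const_mul _),
      lintegral_const_mul _ (hT2 y)]
  simp only [hx]
  rw [lintegral_add_left heI, lintegral_const_mul _ hqT]
  simp [mul_add, mul_assoc, γ]

theorem pi_fin_eq_withDensity {α : Type*} [MeasurableSpace α] {n : ℕ} {μ μ' : Fin n → Measure α}
    [∀ i, SigmaFinite (μ i)] [∀ i, SigmaFinite (μ' i)] {f : Fin n → α → ℝ≥0∞}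
    (hf : ∀ i, Measurable (f i)) (h : ∀ i, μ' i = (μ i).withDensity (f i)) :
    Measure.pi μ' = (Measure.pi μ).withDensity fun x => ∏ i, f i (x i) := by
  obtain rfl : μ' = fun i => (μ i).withDensity (f i) := funext h
  exact pi_fin_withDensity μ f hf

/-! ### Densities of the noise and of the channel output -/

namespace RicianBlockFading

/-- Density of `CN(m, v)` with respect to Lebesgue measure on `ℂ`. -/
noncomputable def cgDensity (m : ℂ) (v : ℝ) (z : ℂ) : ℝ≥0∞ :=
  ENNReal.ofReal ((Real.pi * v)⁻¹ * Real.exp (-(‖z - m‖ ^ 2 / v)))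

theorem measurable_cgDensity (m : ℂ) (v : ℝ) : Measurable (cgDensity m v) := by
  unfold cgDensity
  fun_prop

instance (m : ℂ) (v : ℝ) : IsProbabilityMeasure (complexGaussian m v) :=
  Measure.isProbabilityMeasure_map Complex.measurableEquivRealProd.symm.measurable.aemeasurable

theorem complexGaussian_eq_withDensity (m : ℂ) {v : ℝ} (hv : 0 < v) :
    complexGaussian m v = volume.withDensity (cgDensity m v) := by
  have hv' : (v / 2).toNNReal ≠ 0 := by
    rw [Ne, Real.toNNReal_eq_zero]
    linarith
  have hc : ((v / 2).toNNReal : ℝ) = v / 2 := Real.coe_toNNReal _ (by linarith)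
  have hmp := Complex.volume_preserving_equiv_real_prod.symm
  have hfun : (fun p : ℝ × ℝ => (⟨p.1, p.2⟩ : ℂ)) = Complex.measurableEquivRealProd.symm := rfl
  rw [complexGaussian, gaussianReal_of_var_ne_zero _ hv', gaussianReal_of_var_ne_zero _ hv',
    prod_withDensity (measurable_gaussianPDF _ _) (measurable_gaussianPDF _ _), hfun]
  ext s hs
  rw [Measure.map_apply (MeasurableEquiv.measurable _) hs, withDensity_apply _ hs,
    withDensity_apply _ (MeasurableEquiv.measurable _ hs),
    ← hmp.setLIntegral_comp_preimage_emb (MeasurableEquiv.measurableEmbedding _)]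
  refine lintegral_congr fun p => ?_
  rw [gaussianPDF, gaussianPDF, ← ENNReal.ofReal_mul (gaussianPDFReal_nonneg _ _ _), cgDensity,
    gaussianPDFReal, gaussianPDFReal, hc]
  congr 1
  have h1 : (√(2 * Real.pi * (v / 2)))⁻¹ * (√(2 * Real.pi * (v / 2)))⁻¹ = (Real.pi * v)⁻¹ := by
    rw [← mul_inv, Real.mul_self_sqrt (by positivity)]
    congr 1
    ring
  have h2 : ‖Complex.measurableEquivRealProd.symm p - m‖ ^ 2 =
      (p.1 - m.re) ^ 2 + (p.2 - m.im) ^ 2 := by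
    rw [Complex.sq_norm, Complex.normSq_apply]
    simp [Complex.measurableEquivRealProd_symm_apply, sq]
  rw [h2, mul_mul_mul_comm, h1, ← Real.exp_add]
  congr 2
  field_simp
  ring

theorem complexGaussian_map_affine (a : ℂ) (b : ℝ) :
    (complexGaussian 0 1).map (fun z => a + b * z) = complexGaussian a (b ^ 2) := by
  have hf : Measurable fun p : ℝ × ℝ => (⟨p.1, p.2⟩ : ℂ) :=
    Complex.measurableEquivRealProd.symm.measurable
  have hg : ∀ c, (gaussianReal 0 (1 / 2 : ℝ).toNNReal).map (fun x => c + b * x) =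
      gaussianReal c (b ^ 2 / 2).toNNReal := by
    intro c
    have := Measure.map_map (μ := gaussianReal 0 (1 / 2 : ℝ).toNNReal)
      (measurable_const_add c) (measurable_const_mul b)
    rw [gaussianReal_map_const_mul, gaussianReal_map_const_add] at this
    rw [Function.comp_def] at this
    rw [← this]
    congr 1
    · ring
    · ext
      simp [Real.coe_toNNReal _ (show (0 : ℝ) ≤ b ^ 2 / 2 by positivity)]
      ring
  rw [complexGaussian, complexGaussian, Measure.map_map (by fun_prop) hf]
  have : (fun z : ℂ => a + b * z) ∘ (fun p : ℝ × ℝ => (⟨p.1, p.2⟩ : ℂ)) =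
      (fun p : ℝ × ℝ => (⟨p.1, p.2⟩ : ℂ)) ∘
        Prod.map (fun x => a.re + b * x) fun x => a.im + b * x := by
    funext p
    apply Complex.ext <;> simp
  rw [this, ← Measure.map_map hf (by fun_prop), ← Measure.map_prod_map _ _ (by fun_prop) (by fun_prop)]
  simp only [Complex.zero_re, Complex.zero_im, hg]

/-- Density at `y` of the output of one block with input `x`. -/
noncomputable def blockDensity (κ : ℝ) {nc : ℕ} (x y : Fin nc → ℂ) : ℝ≥0∞ :=
  ∫⁻ h, ∏ i, cgDensity (h * x i) 1 (y i) ∂(complexGaussian (fadingMean κ : ℂ) (fadingVar κ))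

theorem prod_cgDensity {nc : ℕ} (m y : Fin nc → ℂ) :
    ∏ i, cgDensity (m i) 1 (y i) =
      ENNReal.ofReal (Real.pi⁻¹ ^ nc * Real.exp (-sqNorm (y - m))) := by
  simp only [cgDensity, mul_one, div_one]
  rw [← ENNReal.ofReal_prod_of_nonneg fun i _ => by positivity, Finset.prod_mul_distrib,
    ← Real.exp_sum, sqNorm]
  simp

theorem measurable_sqNorm {nc : ℕ} : Measurable (sqNorm : (Fin nc → ℂ) → ℝ) := by
  unfold sqNorm
  fun_prop

theorem sqNorm_nonneg {nc : ℕ} (y : Fin nc → ℂ) : 0 ≤ sqNorm y :=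
  Finset.sum_nonneg fun _ _ => sq_nonneg _

theorem blockDensity_eq (κ : ℝ) {nc : ℕ} (x y : Fin nc → ℂ) :
    blockDensity κ x y = ∫⁻ h : ℂ, ENNReal.ofReal (Real.pi⁻¹ ^ nc * Real.exp (-sqNorm (y - h • x)))
      ∂(complexGaussian (fadingMean κ : ℂ) (fadingVar κ)) := by
  unfold blockDensity
  exact lintegral_congr fun h => prod_cgDensity (h • x) y

theorem measurable_blockDensity (κ : ℝ) {nc : ℕ} :
    Measurable (Function.uncurry (blockDensity κ (nc := nc))) := by
  simp only [Function.uncurry_def, blockDensity_eq]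
  refine Measurable.lintegral_prod_right' (f := fun z : ((Fin nc → ℂ) × (Fin nc → ℂ)) × ℂ =>
    ENNReal.ofReal (Real.pi⁻¹ ^ nc * Real.exp (-sqNorm (z.1.2 - z.2 • z.1.1)))) ?_
  have := measurable_sqNorm (nc := nc)
  fun_prop

theorem noiseLaw_eq_withDensity (ℓ nc : ℕ) :
    noiseLaw ℓ nc = volume.withDensity fun w => ∏ k, ∏ i, cgDensity 0 1 (w k i) := by
  unfold noiseLaw
  refine pi_fin_eq_withDensity (μ := fun _ => volume)
    (f := fun _ (w : Fin nc → ℂ) => ∏ i, cgDensity 0 1 (w i)) (fun _ => ?_) fun _ => ?_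
  · exact Finset.measurable_fun_prod _ fun i _ =>
      (measurable_cgDensity 0 1).comp (measurable_pi_apply i)
  · exact pi_fin_eq_withDensity (μ := fun _ => volume) (fun _ => measurable_cgDensity 0 1)
      fun _ => complexGaussian_eq_withDensity 0 one_pos

instance (ℓ nc : ℕ) : IsProbabilityMeasure (noiseLaw ℓ nc) := by
  unfold noiseLaw
  infer_instance

instance (κ : ℝ) (ℓ : ℕ) : IsProbabilityMeasure (fadingLaw κ ℓ) := by
  unfold fadingLaw
  infer_instance

theorem measurable_noise_density (ℓ nc : ℕ) :
    Measurable fun w : Packet ℓ nc => ∏ k, ∏ i, cgDensity 0 1 (w k i) := by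
  refine Finset.measurable_fun_prod _ fun k _ => Finset.measurable_fun_prod _ fun i _ => ?_
  have : Measurable fun w : Packet ℓ nc => w k i := by fun_prop
  exact (measurable_cgDensity 0 1).comp this

theorem measurable_blockDensity_right (κ : ℝ) {nc : ℕ} (x : Fin nc → ℂ) :
    Measurable (blockDensity κ x) :=
  (measurable_blockDensity κ).of_uncurry_left

theorem measurable_prod_blockDensity (κ : ℝ) {ℓ nc : ℕ} (x : Packet ℓ nc) :
    Measurable fun y : Packet ℓ nc => ∏ k, blockDensity κ (x k) (y k) := by
  refine Finset.measurable_fun_prod _ fun k _ => ?_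
  exact (measurable_blockDensity_right κ (x k)).comp (measurable_pi_apply k)

theorem measurable_channel {ℓ nc : ℕ} (x : Packet ℓ nc) :
    Measurable fun p : (Fin ℓ → ℂ) × Packet ℓ nc =>
      (fun k i => p.1 k * x k i + p.2 k i : Packet ℓ nc) := by
  refine measurable_pi_lambda _ fun k => measurable_pi_lambda _ fun i => ?_
  fun_prop

/-- Given the fading, the output is a translate of the noise, so its density is a translated
Gaussian density. Tonelli moves the average over the fading inside, and independence across blocks
factors it. -/
theorem outputLaw_eq_withDensity (κ : ℝ) {ℓ nc : ℕ} (x : Packet ℓ nc) :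
    outputLaw κ x = volume.withDensity fun y => ∏ k, blockDensity κ (x k) (y k) := by
  have hD := measurable_noise_density ℓ nc
  have hb := measurable_prod_blockDensity κ x
  have hmap := measurable_channel x
  refine Measure.ext_of_lintegral _ fun f hf => ?_
  have hfm : Measurable fun p : (Fin ℓ → ℂ) × Packet ℓ nc =>
      f (fun k i => p.1 k * x k i + p.2 k i) := hf.comp hmap
  rw [outputLaw, lintegral_map hf hmap, lintegral_prod _ hfm.aemeasurable,
    lintegral_withDensity_eq_lintegral_mul _ hb hf]
  have hshift : ∀ h : Fin ℓ → ℂ, ∫⁻ w, f (fun k i => h k * x k i + w k i) ∂(noiseLaw ℓ nc) =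
      ∫⁻ y : Packet ℓ nc, (∏ k, ∏ i, cgDensity (h k * x k i) 1 (y k i)) * f y := by
    intro h
    have hs : Measurable fun w : Packet ℓ nc => (fun k i => h k * x k i + w k i : Packet ℓ nc) := by
      fun_prop
    have hfs : Measurable fun w : Packet ℓ nc => f (fun k i => h k * x k i + w k i) := hf.comp hs
    rw [noiseLaw_eq_withDensity, lintegral_withDensity_eq_lintegral_mul _ hD hfs]
    have htr := lintegral_sub_right_eq_self (μ := (volume : Measure (Packet ℓ nc)))
      ((fun w : Packet ℓ nc => ∏ k, ∏ i, cgDensity 0 1 (w k i)) *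
        fun w : Packet ℓ nc => f (fun k i => h k * x k i + w k i))
      (fun k i => h k * x k i : Packet ℓ nc)
    rw [← htr]
    refine lintegral_congr fun y => ?_
    simp [cgDensity]
  simp only [hshift]
  have hj : Measurable fun z : (Fin ℓ → ℂ) × Packet ℓ nc =>
      ∏ k, ∏ i, cgDensity (z.1 k * x k i) 1 (z.2 k i) := by
    refine Finset.measurable_fun_prod _ fun k _ => Finset.measurable_fun_prod _ fun i _ => ?_
    unfold cgDensity
    fun_prop
  rw [lintegral_lintegral_swap (f := fun (h : Fin ℓ → ℂ) (y : Packet ℓ nc) =>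
    (∏ k, ∏ i, cgDensity (h k * x k i) 1 (y k i)) * f y) (hj.mul (hf.comp measurable_snd)).aemeasurable]
  refine lintegral_congr fun y => ?_
  have hjy : Measurable fun h : Fin ℓ → ℂ => ∏ k, ∏ i, cgDensity (h k * x k i) 1 (y k i) := by
    refine Finset.measurable_fun_prod _ fun k _ => Finset.measurable_fun_prod _ fun i _ => ?_
    unfold cgDensity
    fun_prop
  rw [lintegral_mul_const _ hjy, Pi.mul_apply]
  congr 1
  unfold fadingLaw blockDensity
  refine lintegral_pi_fin_prod _ (fun k h => ∏ i, cgDensity (h * x k i) 1 (y k i)) fun k => ?_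
  unfold cgDensity
  fun_prop

/-! ### Unitary invariance -/

/-- Extend both normalized vectors to orthonormal bases, at the same index, and map one basis to the
other. -/
theorem exists_linearIsometryEquiv_apply_eq {n : ℕ} (x x' : EuclideanSpace ℂ (Fin n))
    (h : ‖x‖ = ‖x'‖) (hx : x ≠ 0) :
    ∃ V : EuclideanSpace ℂ (Fin n) ≃ₗᵢ[ℂ] EuclideanSpace ℂ (Fin n), V x = x' := by
  have hx0 : ‖x‖ ≠ 0 := norm_ne_zero_iff.2 hx
  have hn : n ≠ 0 := by
    rintro rfl
    exact hx (Subsingleton.elim _ _)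
  let i0 : Fin n := ⟨0, Nat.pos_of_ne_zero hn⟩
  have hex : ∀ z : EuclideanSpace ℂ (Fin n), ‖z‖ ≠ 0 →
      ∃ b : OrthonormalBasis (Fin n) ℂ (EuclideanSpace ℂ (Fin n)),
        b i0 = ((‖z‖ : ℂ)⁻¹) • z := by
    intro z hz
    obtain ⟨b, hb⟩ := Orthonormal.exists_orthonormalBasis_extension_of_card_eq (𝕜 := ℂ)
      (E := EuclideanSpace ℂ (Fin n)) (ι := Fin n) (by simp)
      (v := fun _ => ((‖z‖ : ℂ)⁻¹) • z) (s := {i0}) (by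
        refine ⟨fun i => ?_, fun i j hij => (hij (Subsingleton.elim _ _)).elim⟩
        simp [norm_smul, hz])
    exact ⟨b, hb i0 rfl⟩
  obtain ⟨b, hb⟩ := hex x hx0
  obtain ⟨b', hb'⟩ := hex x' (h ▸ hx0)
  refine ⟨b.repr.trans b'.repr.symm, ?_⟩
  have e : ∀ z : EuclideanSpace ℂ (Fin n), ‖z‖ ≠ 0 → (‖z‖ : ℂ) • ((‖z‖ : ℂ)⁻¹ • z) = z := by
    intro z hz
    rw [smul_smul, mul_inv_cancel₀ (by exact_mod_cast hz), one_smul]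
  rw [← e x hx0, map_smul, ← hb]
  simp [hb', h, e x' (h ▸ hx0)]

theorem sqNorm_ofLp {n : ℕ} (x : EuclideanSpace ℂ (Fin n)) : sqNorm x.ofLp = ‖x‖ ^ 2 := by
  rw [EuclideanSpace.norm_sq_eq, sqNorm]

/-- Volume on `Fin n → ℂ` is the product measure and its norm is the sup norm. Pushed to the
Euclidean space it is a Haar measure, hence a multiple of the volume there, which isometries
preserve. -/
theorem LinearIsometryEquiv.measurePreserving_ofLp {n : ℕ}
    (V : EuclideanSpace ℂ (Fin n) ≃ₗᵢ[ℂ] EuclideanSpace ℂ (Fin n)) :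
    MeasurePreserving (fun y : Fin n → ℂ => (V (WithLp.toLp 2 y)).ofLp) := by
  let L : (Fin n → ℂ) ≃L[ℂ] EuclideanSpace ℂ (Fin n) := (EuclideanSpace.equiv (Fin n) ℂ).symm
  let W : EuclideanSpace ℂ (Fin n) ≃ₗᵢ[ℝ] EuclideanSpace ℂ (Fin n) :=
    { V.toLinearEquiv.restrictScalars ℝ with norm_map' := V.norm_map }
  have hL : Measurable L := L.continuous.measurable
  have hL' : Measurable L.symm := L.symm.continuous.measurable
  have : (Measure.map L volume).IsAddHaarMeasure := L.isAddHaarMeasure_map volume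
  have hsmul := Measure.isAddLeftInvariant_eq_smul (Measure.map L volume)
    (volume : Measure (EuclideanSpace ℂ (Fin n)))
  have h1 : MeasurePreserving L volume (Measure.map L volume) := ⟨hL, rfl⟩
  have h2 : MeasurePreserving W (Measure.map L volume) (Measure.map L volume) := by
    rw [hsmul]
    exact W.measurePreserving.smul_measure _
  have h3 : MeasurePreserving L.symm (Measure.map L volume) volume := by
    refine ⟨hL', ?_⟩
    rw [Measure.map_map hL' hL]
    simp
  exact h3.comp (h2.comp h1)

/-- For a unitary `V` with `V x = x'` one has `‖V y - h • x'‖ = ‖y - h • x‖` for every fading value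
`h`. -/
theorem exists_measurePreserving_blockDensity_eq (κ : ℝ) {nc : ℕ} (x x' : Fin nc → ℂ)
    (h : sqNorm x = sqNorm x') (hx : x ≠ 0) :
    ∃ T : (Fin nc → ℂ) → (Fin nc → ℂ), MeasurePreserving T ∧ (∀ y, sqNorm (T y) = sqNorm y) ∧
      ∀ y, blockDensity κ x' (T y) = blockDensity κ x y := by
  have hnorm : ‖WithLp.toLp 2 x‖ = ‖WithLp.toLp 2 x'‖ := by
    rw [← sq_eq_sq₀ (norm_nonneg _) (norm_nonneg _), ← sqNorm_ofLp, ← sqNorm_ofLp]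
    exact h
  obtain ⟨V, hV⟩ := exists_linearIsometryEquiv_apply_eq _ _ hnorm
    (fun h0 => hx (by simpa using h0))
  have hT : ∀ y : Fin nc → ℂ, sqNorm (V (WithLp.toLp 2 y)).ofLp = sqNorm y := fun y => by
    rw [sqNorm_ofLp, V.norm_map, ← sqNorm_ofLp]
  refine ⟨fun y => (V (WithLp.toLp 2 y)).ofLp, LinearIsometryEquiv.measurePreserving_ofLp V, hT,
    fun y => ?_⟩
  rw [blockDensity_eq, blockDensity_eq]
  refine lintegral_congr fun h => ?_
  rw [← hT (y - h • x)]
  congr 4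
  rw [WithLp.toLp_sub, WithLp.toLp_smul, map_sub, map_smul, hV]
  rfl

end RicianBlockFading

/-! ### Output density under the uniform spherical input -/

theorem hyp_nonneg {n : ℕ} {t : ℝ} (ht : 0 ≤ t) : 0 ≤ hyp n t :=
  tsum_nonneg fun k => by positivity

theorem measurable_hyp (n : ℕ) : Measurable (hyp n) := by
  unfold hyp
  fun_prop

namespace RicianBlockFading

theorem fadingVar_pos {κ : ℝ} (hκ : 0 ≤ κ) : 0 < fadingVar κ := by
  unfold fadingVar
  positivity

theorem besselI_two_mul_sqrt (m : ℕ) {t : ℝ} (ht : 0 ≤ t) :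
    besselI m (2 * √t) = √t ^ m / m.factorial * hyp (m + 1) t := by
  rw [besselI, hyp, ← tsum_mul_left]
  refine tsum_congr fun k => ?_
  rw [mul_div_cancel_left₀ _ two_ne_zero, pow_add, pow_mul, Real.sq_sqrt ht, Nat.add_sub_cancel]
  have : (m.factorial : ℝ) ≠ 0 := by positivity
  field_simp

/-- The squared modulus of a `CN(m, v)` variable is noncentral chi-squared. -/
theorem lintegral_complexGaussian_norm_sq (m : ℝ) {v : ℝ} (hv : 0 < v) {g : ℝ → ℝ≥0∞}
    (hg : Measurable g) :
    ∫⁻ h, g (‖h‖ ^ 2) ∂(complexGaussian (m : ℂ) v) =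
      ∫⁻ z in Set.Ioi (0 : ℝ),
        ENNReal.ofReal (v⁻¹ * Real.exp (-((z + m ^ 2) / v)) * hyp 1 (z * m ^ 2 / v ^ 2)) * g z := by
  have hgn : Measurable fun h : ℂ => g (‖h‖ ^ 2) := hg.comp (by fun_prop)
  rw [complexGaussian_eq_withDensity _ hv,
    lintegral_withDensity_eq_lintegral_mul _ (measurable_cgDensity _ _) hgn,
    lintegral_polar volume ((measurable_cgDensity _ _).mul hgn),
    ← lintegral_Ioi_sq fun z => ENNReal.ofReal
      (v⁻¹ * Real.exp (-((z + m ^ 2) / v)) * hyp 1 (z * m ^ 2 / v ^ 2)) * g z]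
  refine setLIntegral_congr_fun measurableSet_Ioi fun r hr => ?_
  have hr0 : (0 : ℝ) < r := hr
  -- Expanding `‖r • u - m‖ ^ 2` leaves the direction `u` only in one exponential of an inner
  -- product, to which the sphere formula with `n = 1` applies.
  have e1 : ∀ u : Metric.sphere (0 : ℂ) 1,
      ENNReal.ofReal (r ^ (Module.finrank ℝ ℂ - 1)) *
        (cgDensity m v * fun h : ℂ => g (‖h‖ ^ 2)) (r • (u : ℂ)) =
      g (r ^ 2) * ENNReal.ofReal (r * ((Real.pi * v)⁻¹ * Real.exp (-((r ^ 2 + m ^ 2) / v)))) *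
        ENNReal.ofReal (Real.exp (2 * ⟪(r / v) • (m : ℂ), u⟫)) := by
    intro u
    have hu : ‖(u : ℂ)‖ = 1 := norm_eq_of_mem_sphere u
    have hn : ‖r • (u : ℂ)‖ ^ 2 = r ^ 2 := by
      rw [norm_smul, hu, mul_one, Real.norm_eq_abs, sq_abs]
    have hd : ‖r • (u : ℂ) - m‖ ^ 2 = r ^ 2 - 2 * (r * ⟪(m : ℂ), u⟫) + m ^ 2 := by
      rw [norm_sub_sq_real, hn, real_inner_smul_left, real_inner_comm, Complex.norm_real,
        Real.norm_eq_abs, sq_abs]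
    rw [Complex.finrank_real_complex, Pi.mul_apply, hn, cgDensity, hd, real_inner_smul_left,
      mul_comm (ENNReal.ofReal ((Real.pi * v)⁻¹ * _)), mul_left_comm, mul_assoc,
      ← ENNReal.ofReal_mul (by positivity), ← ENNReal.ofReal_mul (by positivity)]
    congr 2
    rw [mul_assoc r, mul_assoc (Real.pi * v)⁻¹, ← Real.exp_add, Nat.add_one_sub_one, pow_one]
    congr 3
    field_simp
    ring
  refine (lintegral_congr e1).trans ?_
  rw [lintegral_const_mul _ (by fun_prop),
    lintegral_toSphere_exp_inner (n := 1) le_rfl (by simp [Complex.finrank_real_complex]),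
    mul_assoc, ← ENNReal.ofReal_mul (by positivity), mul_comm (g _),
    ← mul_assoc (ENNReal.ofReal (2 * r)), ← ENNReal.ofReal_mul (by positivity)]
  congr 2
  rw [norm_smul, mul_pow, Complex.norm_real, Real.norm_eq_abs, Real.norm_eq_abs, sq_abs, sq_abs,
    div_pow, div_mul_eq_mul_div, Nat.sub_self, Nat.factorial_zero, Nat.cast_one]
  field_simp

/-- The uniform law on the unit sphere of `ℂ ^ n`. -/
noncomputable def unifSphere (n : ℕ) : Measure (Metric.sphere (0 : EuclideanSpace ℂ (Fin n)) 1) :=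
  ((volume : Measure (EuclideanSpace ℂ (Fin n))).toSphere Set.univ)⁻¹ •
    (volume : Measure (EuclideanSpace ℂ (Fin n))).toSphere

theorem finrank_real_euclideanSpace (n : ℕ) :
    Module.finrank ℝ (EuclideanSpace ℂ (Fin n)) = 2 * n := by
  rw [← Module.finrank_mul_finrank ℝ ℂ]
  simp

theorem toSphere_univ_eq {n : ℕ} (hn : 1 ≤ n) :
    (volume : Measure (EuclideanSpace ℂ (Fin n))).toSphere Set.univ =
      ENNReal.ofReal (2 * Real.pi ^ n / (n - 1).factorial) := by
  have := lintegral_toSphere_exp_inner hn (finrank_real_euclideanSpace n) 0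
  simpa [hyp_zero] using this

theorem isProbabilityMeasure_unifSphere {n : ℕ} (hn : 1 ≤ n) :
    IsProbabilityMeasure (unifSphere n) := by
  refine ⟨?_⟩
  rw [unifSphere, Measure.smul_apply, smul_eq_mul]
  refine ENNReal.inv_mul_cancel ?_ (measure_ne_top _ _)
  rw [toSphere_univ_eq hn]
  have : 0 < 2 * Real.pi ^ n / (n - 1).factorial := by positivity
  simpa using this

theorem lintegral_unifSphere_exp_inner {n : ℕ} (hn : 1 ≤ n) (a : EuclideanSpace ℂ (Fin n)) :
    ∫⁻ u, ENNReal.ofReal (Real.exp (2 * ⟪a, (u : EuclideanSpace ℂ (Fin n))⟫)) ∂(unifSphere n) =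
      ENNReal.ofReal (hyp n (‖a‖ ^ 2)) := by
  have h0 : 0 < 2 * Real.pi ^ n / (n - 1).factorial := by positivity
  rw [unifSphere, lintegral_smul_measure, lintegral_toSphere_exp_inner hn
    (finrank_real_euclideanSpace n), toSphere_univ_eq hn, ENNReal.ofReal_mul h0.le, smul_eq_mul,
    ← mul_assoc, ENNReal.inv_mul_cancel (by simpa using h0) ENNReal.ofReal_ne_top, one_mul]

/-- The codeword of power `P = nc ρ` in direction `u`. -/
noncomputable def spherePoint {n : ℕ} (P : ℝ) (u : Metric.sphere (0 : EuclideanSpace ℂ (Fin n)) 1) :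
    Fin n → ℂ := fun i => (√P : ℂ) * u.1.ofLp i

theorem measurable_spherePoint {n : ℕ} (P : ℝ) : Measurable (spherePoint P (n := n)) := by
  unfold spherePoint
  fun_prop

theorem sqNorm_spherePoint {n : ℕ} {P : ℝ} (hP : 0 ≤ P)
    (u : Metric.sphere (0 : EuclideanSpace ℂ (Fin n)) 1) : sqNorm (spherePoint P u) = P := by
  have hu := sqNorm_ofLp u.1
  rw [norm_eq_of_mem_sphere u, one_pow, sqNorm] at hu
  simp only [sqNorm, spherePoint, norm_mul, mul_pow, ← Finset.mul_sum, hu]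
  simp [Complex.norm_real, Real.sq_sqrt hP]

theorem sqNorm_sub_smul_spherePoint {n : ℕ} {P : ℝ} (hP : 0 ≤ P)
    (u : Metric.sphere (0 : EuclideanSpace ℂ (Fin n)) 1) (y : Fin n → ℂ) (h : ℂ) :
    sqNorm (y - h • spherePoint P u) = sqNorm y + ‖h‖ ^ 2 * P -
      2 * ⟪((√P : ℂ) * starRingEnd ℂ h) • (WithLp.toLp 2 y), u.1⟫ := by
  have hu : ‖u.1‖ = 1 := norm_eq_of_mem_sphere u
  have e : y - h • spherePoint P u =
      (WithLp.toLp 2 y - (h * (√P : ℂ)) • u.1 : EuclideanSpace ℂ (Fin n)).ofLp := by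
    funext i
    simp [spherePoint, mul_assoc]
  have hi : ⟪WithLp.toLp 2 y, (h * (√P : ℂ)) • u.1⟫ =
      ⟪((√P : ℂ) * starRingEnd ℂ h) • (WithLp.toLp 2 y), u.1⟫ := by
    simp only [PiLp.inner_apply]
    refine Finset.sum_congr rfl fun i _ => ?_
    simp [Complex.inner]
    ring
  rw [e, sqNorm_ofLp, norm_sub_sq_real, hi, ← sqNorm_ofLp, norm_smul, hu, norm_mul,
    Complex.norm_real, mul_one, mul_pow, Real.norm_eq_abs, sq_abs, Real.sq_sqrt hP]
  ring

/-- Output density of one block under the uniform input on the sphere of power `P`. -/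
noncomputable def mixDensity (κ P : ℝ) {n : ℕ} (y : Fin n → ℂ) : ℝ≥0∞ :=
  ∫⁻ u, blockDensity κ (spherePoint P u) y ∂(unifSphere n)

/-- Average over the sphere first, with the fading fixed. The result depends on `y` only through
`sqNorm y` and on `h` only through `‖h‖ ^ 2`. -/
theorem mixDensity_eq (κ : ℝ) {P : ℝ} (hP : 0 ≤ P) {n : ℕ} (hn : 1 ≤ n) (y : Fin n → ℂ) :
    mixDensity κ P y = ∫⁻ h : ℂ, ENNReal.ofReal (Real.pi⁻¹ ^ n *
      Real.exp (-(sqNorm y + ‖h‖ ^ 2 * P)) * hyp n (P * ‖h‖ ^ 2 * sqNorm y))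
        ∂(complexGaussian (fadingMean κ : ℂ) (fadingVar κ)) := by
  have := isProbabilityMeasure_unifSphere hn
  unfold mixDensity
  simp only [blockDensity_eq]
  have hm : Measurable fun z : (Metric.sphere (0 : EuclideanSpace ℂ (Fin n)) 1) × ℂ =>
      ENNReal.ofReal (Real.pi⁻¹ ^ n * Real.exp (-sqNorm (y - z.2 • spherePoint P z.1))) := by
    have h1 := measurable_sqNorm (nc := n)
    have h2 := measurable_spherePoint (n := n) P
    fun_prop
  rw [lintegral_lintegral_swap hm.aemeasurable]
  refine lintegral_congr fun h => ?_
  have e : ∀ u : Metric.sphere (0 : EuclideanSpace ℂ (Fin n)) 1,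
      ENNReal.ofReal (Real.pi⁻¹ ^ n * Real.exp (-sqNorm (y - h • spherePoint P u))) =
      ENNReal.ofReal (Real.pi⁻¹ ^ n * Real.exp (-(sqNorm y + ‖h‖ ^ 2 * P))) *
        ENNReal.ofReal (Real.exp
          (2 * ⟪((√P : ℂ) * starRingEnd ℂ h) • (WithLp.toLp 2 y), u.1⟫)) := by
    intro u
    rw [← ENNReal.ofReal_mul (by positivity), sqNorm_sub_smul_spherePoint hP, mul_assoc,
      ← Real.exp_add]
    congr 3
    ring
  simp only [e]
  rw [lintegral_const_mul _ (by fun_prop), lintegral_unifSphere_exp_inner hn,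
    ← ENNReal.ofReal_mul (by positivity), norm_smul, mul_pow, ← sqNorm_ofLp, norm_mul,
    RCLike.norm_conj, Complex.norm_real, mul_pow, Real.norm_eq_abs, sq_abs, Real.sq_sqrt hP]

theorem mixDensity_congr (κ : ℝ) {P : ℝ} (hP : 0 ≤ P) {n : ℕ} (hn : 1 ≤ n) {y y' : Fin n → ℂ}
    (h : sqNorm y = sqNorm y') : mixDensity κ P y = mixDensity κ P y' := by
  rw [mixDensity_eq κ hP hn, mixDensity_eq κ hP hn, h]

theorem measurable_mixDensity (κ P : ℝ) {n : ℕ} : Measurable (mixDensity κ P (n := n)) := by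
  have : SFinite (unifSphere n) := by
    unfold unifSphere
    infer_instance
  have h : Measurable fun z : (Metric.sphere (0 : EuclideanSpace ℂ (Fin n)) 1) × (Fin n → ℂ) =>
      (spherePoint P z.1, z.2) :=
    ((measurable_spherePoint P).comp measurable_fst).prodMk measurable_snd
  exact Measurable.lintegral_prod_left' ((measurable_blockDensity κ).comp h)

theorem blockDensity_le (κ : ℝ) {n : ℕ} (x y : Fin n → ℂ) :
    blockDensity κ x y ≤ ENNReal.ofReal (Real.pi⁻¹ ^ n) := by
  rw [blockDensity_eq]
  calc _ ≤ ∫⁻ _ : ℂ, ENNReal.ofReal (Real.pi⁻¹ ^ n)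
      ∂(complexGaussian (fadingMean κ : ℂ) (fadingVar κ)) := by
        refine lintegral_mono fun h => ENNReal.ofReal_le_ofReal ?_
        refine mul_le_of_le_one_right (by positivity) ?_
        rw [Real.exp_le_one_iff]
        have := sqNorm_nonneg (y - h • x)
        linarith
    _ = _ := by simp

theorem blockDensity_pos (κ : ℝ) {n : ℕ} (x y : Fin n → ℂ) : 0 < blockDensity κ x y := by
  rw [blockDensity_eq]
  have h1 := measurable_sqNorm (nc := n)
  rw [lintegral_pos_iff_support (by fun_prop)]
  have : Function.support (fun h : ℂ =>
      ENNReal.ofReal (Real.pi⁻¹ ^ n * Real.exp (-sqNorm (y - h • x)))) = Set.univ := by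
    ext h
    have : 0 < Real.pi⁻¹ ^ n * Real.exp (-sqNorm (y - h • x)) := by positivity
    simpa using this
  rw [this]
  simp

theorem mixDensity_ne_top (κ P : ℝ) {n : ℕ} (hn : 1 ≤ n) (y : Fin n → ℂ) :
    mixDensity κ P y ≠ ∞ := by
  have := isProbabilityMeasure_unifSphere hn
  refine ne_top_of_le_ne_top (b := ENNReal.ofReal (Real.pi⁻¹ ^ n)) ENNReal.ofReal_ne_top ?_
  calc _ ≤ ∫⁻ _, ENNReal.ofReal (Real.pi⁻¹ ^ n) ∂(unifSphere n) :=
        lintegral_mono fun u => blockDensity_le κ _ y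
    _ = _ := by simp

theorem mixDensity_ne_zero (κ P : ℝ) {n : ℕ} (hn : 1 ≤ n) (y : Fin n → ℂ) :
    mixDensity κ P y ≠ 0 := by
  have := isProbabilityMeasure_unifSphere hn
  have hm : Measurable fun u => blockDensity κ (spherePoint P u) y :=
    ((measurable_blockDensity κ).of_uncurry_right).comp (measurable_spherePoint P)
  rw [mixDensity, ← pos_iff_ne_zero, lintegral_pos_iff_support hm]
  have : Function.support (fun u => blockDensity κ (spherePoint P u) y) = Set.univ := by
    ext u
    simpa using (blockDensity_pos κ (spherePoint P u) y).ne'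
  rw [this]
  simp

/-- The variable `z` of the Bessel integral is `‖h‖ ^ 2`, integrated against its noncentral
chi-squared density. At `sqNorm y = 0` the integrand of `besselIntegral` would divide by zero when
`n > 1`. Positivity is what later permits undoing the logarithm in `blockS`. -/
theorem mixDensity_eq_besselIntegral {κ ρ : ℝ} (hκ : 0 ≤ κ) (hρ : 0 < ρ) {n : ℕ} (hn : 1 ≤ n)
    {y : Fin n → ℂ} (hy : 0 < sqNorm y) :
    mixDensity κ (n * ρ) y = ENNReal.ofReal
      (Real.pi⁻¹ ^ n * Real.exp (-(fadingMean κ ^ 2 / fadingVar κ) - sqNorm y) *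
        (fadingVar κ)⁻¹ * Real.Gamma n * besselIntegral κ ρ n (sqNorm y)) ∧
      0 < besselIntegral κ ρ n (sqNorm y) := by
  have hv := fadingVar_pos hκ
  set v := fadingVar κ
  set m := fadingMean κ
  set s := sqNorm y
  have hn0 : (0 : ℝ) < n := by exact_mod_cast hn
  have hP : 0 ≤ n * ρ := by positivity
  have hG : Real.Gamma n = (n - 1).factorial := by
    obtain ⟨j, rfl⟩ : ∃ j, n = j + 1 := ⟨n - 1, by omega⟩
    push_cast
    rw [Real.Gamma_nat_eq_factorial]
  let C : ℝ := Real.pi⁻¹ ^ n * Real.exp (-(m ^ 2 / v) - s) * v⁻¹ * Real.Gamma n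
  have hC : 0 < C := by
    have : 0 < Real.Gamma n := Real.Gamma_pos_of_pos hn0
    positivity
  let φ : ℝ → ℝ := fun z =>
    Real.exp (-(ρ * n + v⁻¹) * z) / √(s * ρ * n * z) ^ (n - 1)
      * besselI 0 (2 * √(z * m ^ 2 / v ^ 2)) * besselI (n - 1) (2 * √(s * ρ * n * z))
  let φ' : ℝ → ℝ := fun z =>
    Real.exp (-(ρ * n + v⁻¹) * z) / (n - 1).factorial
      * hyp 1 (z * m ^ 2 / v ^ 2) * hyp n (s * ρ * n * z)
  -- The power of the square root in the denominator cancels the leading factor of `I_{n-1}`,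
  -- leaving entire series in `z`.
  have hφ : ∀ z ∈ Set.Ioi (0 : ℝ), φ z = φ' z := by
    intro z hz
    have hz0 : (0 : ℝ) < z := hz
    have ht : 0 < s * ρ * n * z := by positivity
    simp only [φ, φ']
    rw [besselI_two_mul_sqrt 0 (by positivity), besselI_two_mul_sqrt (n - 1) ht.le,
      Nat.sub_add_cancel hn]
    have : √(s * ρ * n * z) ^ (n - 1) ≠ 0 := pow_ne_zero _ (Real.sqrt_pos.2 ht).ne'
    simp
    field_simp
  have hφ0 : ∀ z ∈ Set.Ioi (0 : ℝ), 0 ≤ φ' z := by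
    intro z hz
    have hz0 : (0 : ℝ) < z := hz
    have h1 : 0 ≤ hyp 1 (z * m ^ 2 / v ^ 2) := hyp_nonneg (by positivity)
    have h2 : 0 ≤ hyp n (s * ρ * n * z) := hyp_nonneg (by positivity)
    positivity
  have hφm : Measurable φ' := by
    have h1 := measurable_hyp 1
    have h2 := measurable_hyp n
    fun_prop
  have hI : besselIntegral κ ρ n s = ∫ z in Set.Ioi (0 : ℝ), φ' z :=
    setIntegral_congr_fun measurableSet_Ioi hφ
  have hL : mixDensity κ (n * ρ) y = ENNReal.ofReal C * ∫⁻ z in Set.Ioi (0 : ℝ), ENNReal.ofReal (φ' z) := by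
    let g : ℝ → ℝ≥0∞ := fun z => ENNReal.ofReal (Real.pi⁻¹ ^ n *
      Real.exp (-(s + z * (n * ρ))) * hyp n (n * ρ * z * s))
    have hg : Measurable g := by
      have h2 := measurable_hyp n
      fun_prop
    have h1 := lintegral_complexGaussian_norm_sq m hv hg
    rw [mixDensity_eq κ hP hn]
    change ∫⁻ h : ℂ, g (‖h‖ ^ 2) ∂(complexGaussian (m : ℂ) v) = _
    rw [h1, ← lintegral_const_mul _ (by fun_prop)]
    refine setLIntegral_congr_fun measurableSet_Ioi fun z hz => ?_
    have hz0 : (0 : ℝ) < z := hz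
    have h1 : 0 ≤ hyp 1 (z * m ^ 2 / v ^ 2) := hyp_nonneg (by positivity)
    simp only [g]
    rw [← ENNReal.ofReal_mul (by positivity), ← ENNReal.ofReal_mul hC.le]
    congr 1
    simp only [C, φ']
    have he : Real.exp (-((z + m ^ 2) / v)) * Real.exp (-(s + z * (n * ρ))) =
        Real.exp (-(m ^ 2 / v) - s) * Real.exp (-(ρ * n + v⁻¹) * z) := by
      rw [← Real.exp_add, ← Real.exp_add]
      congr 1
      field_simp
      ring
    rw [hG, show n * ρ * z * s = s * ρ * n * z by ring]
    have hf : ((n - 1).factorial : ℝ) ≠ 0 := by positivity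
    calc _ = Real.pi⁻¹ ^ n * v⁻¹ * hyp 1 (z * m ^ 2 / v ^ 2) * hyp n (s * ρ * n * z) *
          (Real.exp (-((z + m ^ 2) / v)) * Real.exp (-(s + z * (n * ρ)))) := by ring
      _ = _ := by
        rw [he]
        field_simp
  -- Integrability comes from the boundedness of the output density, so no growth estimate for
  -- Bessel functions is needed.
  have hfin : ∫⁻ z in Set.Ioi (0 : ℝ), ENNReal.ofReal (φ' z) ≠ ∞ := by
    intro h
    apply mixDensity_ne_top κ (n * ρ) hn y
    rw [hL, h, ENNReal.mul_top (by simpa using hC)]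
  have hae : 0 ≤ᵐ[volume.restrict (Set.Ioi 0)] φ' := by
    filter_upwards [ae_restrict_mem measurableSet_Ioi] with z hz using hφ0 z hz
  have hint : Integrable φ' (volume.restrict (Set.Ioi 0)) :=
    ⟨hφm.aestronglyMeasurable, (hasFiniteIntegral_iff_ofReal hae).2 hfin.lt_top⟩
  rw [← ofReal_integral_eq_lintegral_ofReal hint hae, ← hI, ← ENNReal.ofReal_mul hC.le] at hL
  refine ⟨hL, ?_⟩
  have h0 := mixDensity_ne_zero κ (n * ρ) hn y
  rw [hL, Ne, ENNReal.ofReal_eq_zero, not_le] at h0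
  exact pos_of_mul_pos_right h0 hC.le

/-! ### The codeword on the first axis -/

theorem lintegral_cgDensity (m : ℂ) {v : ℝ} (hv : 0 < v) : ∫⁻ z, cgDensity m v z = 1 := by
  have h := measure_univ (μ := complexGaussian m v)
  rwa [complexGaussian_eq_withDensity m hv, withDensity_apply _ MeasurableSet.univ,
    Measure.restrict_univ] at h

/-- Gaussian conjugacy: prior times likelihood equals marginal times posterior, and the posterior
integrates to `1`. -/
theorem lintegral_cgDensity_mul (m a : ℝ) {v : ℝ} (hv : 0 < v) (y : ℂ) :
    ∫⁻ h, cgDensity (h * (a : ℂ)) 1 y ∂(complexGaussian (m : ℂ) v) =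
      cgDensity ((m * a : ℝ) : ℂ) (v * a ^ 2 + 1) y := by
  have hb : 0 < v * a ^ 2 + 1 := by positivity
  have hw : 0 < v / (v * a ^ 2 + 1) := by positivity
  have hmeas : Measurable fun h : ℂ => cgDensity (h * (a : ℂ)) 1 y := by
    unfold cgDensity
    fun_prop
  rw [complexGaussian_eq_withDensity _ hv,
    lintegral_withDensity_eq_lintegral_mul _ (measurable_cgDensity _ _) hmeas]
  -- Posterior mean of the fading coefficient given the observation `y`.
  let c : ℂ := ⟨(m + v * a * y.re) / (v * a ^ 2 + 1), v * a * y.im / (v * a ^ 2 + 1)⟩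
  have key : ∀ h : ℂ, (cgDensity m v * fun h => cgDensity (h * (a : ℂ)) 1 y) h =
      cgDensity ((m * a : ℝ) : ℂ) (v * a ^ 2 + 1) y * cgDensity c (v / (v * a ^ 2 + 1)) h := by
    intro h
    simp only [Pi.mul_apply, cgDensity]
    rw [← ENNReal.ofReal_mul (by positivity), ← ENNReal.ofReal_mul (by positivity),
      mul_mul_mul_comm (Real.pi * v)⁻¹, mul_mul_mul_comm (Real.pi * (v * a ^ 2 + 1))⁻¹,
      ← Real.exp_add, ← Real.exp_add]
    congr 2
    · field_simp
    · congr 1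
      simp only [Complex.sq_norm, Complex.normSq_apply, c]
      simp
      field_simp
      ring
  rw [lintegral_congr key, lintegral_const_mul _ (measurable_cgDensity _ _),
    lintegral_cgDensity _ hw, mul_one]

/-- The input block whose energy `P` is concentrated in the first entry. -/
noncomputable def axisPoint (n : ℕ) (P : ℝ) : Fin n → ℂ := fun i => if i.val = 0 then (√P : ℂ) else 0

theorem sqNorm_axisPoint {n : ℕ} (hn : 1 ≤ n) {P : ℝ} (hP : 0 ≤ P) :
    sqNorm (axisPoint n P) = P := by
  obtain ⟨j, rfl⟩ : ∃ j, n = j + 1 := ⟨n - 1, by omega⟩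
  simp [sqNorm, axisPoint, Fin.sum_univ_succ, Complex.norm_real, Real.sq_sqrt hP]

/-- Entrywise means of the output block for the input `axisPoint`. -/
noncomputable def axisMean (κ P : ℝ) {n : ℕ} (i : Fin n) : ℂ :=
  if i.val = 0 then ((fadingMean κ * √P : ℝ) : ℂ) else 0

/-- Entrywise variances of the output block for the input `axisPoint`. -/
noncomputable def axisVar (κ P : ℝ) {n : ℕ} (i : Fin n) : ℝ :=
  if i.val = 0 then fadingVar κ * P + 1 else 1

theorem axisVar_pos {κ P : ℝ} (hκ : 0 ≤ κ) (hP : 0 ≤ P) {n : ℕ} (i : Fin n) : 0 < axisVar κ P i := by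
  have := fadingVar_pos hκ
  unfold axisVar
  split_ifs <;> positivity

theorem blockDensity_axisPoint {κ P : ℝ} (hκ : 0 ≤ κ) (hP : 0 ≤ P) {n : ℕ} (hn : 1 ≤ n)
    (y : Fin n → ℂ) :
    blockDensity κ (axisPoint n P) y = ∏ i, cgDensity (axisMean κ P i) (axisVar κ P i) (y i) := by
  obtain ⟨j, rfl⟩ : ∃ j, n = j + 1 := ⟨n - 1, by omega⟩
  have hmeas : Measurable fun h : ℂ => cgDensity (h * (√P : ℂ)) 1 (y 0) := by
    unfold cgDensity
    fun_prop
  have h := lintegral_cgDensity_mul (fadingMean κ) √P (fadingVar_pos hκ) (y 0)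
  rw [Real.sq_sqrt hP] at h
  simp only [blockDensity, Fin.prod_univ_succ, axisPoint, axisMean, axisVar]
  simp only [Fin.val_zero, if_true, Fin.val_succ, Nat.succ_ne_zero, if_false, mul_zero]
  rw [lintegral_mul_const _ hmeas, h]

theorem tildeNoise_apply (κ ρ : ℝ) {n : ℕ} (w : Fin n → ℂ) (i : Fin n) :
    tildeNoise κ ρ w i = axisMean κ (n * ρ) i + (√(axisVar κ (n * ρ) i) : ℂ) * w i := by
  unfold tildeNoise axisMean axisVar
  split_ifs
  · rw [mul_assoc]
  · simp

theorem measurable_tildeNoise (κ ρ : ℝ) {n : ℕ} : Measurable (tildeNoise κ ρ (nc := n)) := by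
  refine measurable_pi_lambda _ fun i => ?_
  simp only [tildeNoise_apply]
  fun_prop

theorem blockDensity_axisPoint_tildeNoise {κ ρ : ℝ} (hκ : 0 ≤ κ) (hρ : 0 < ρ) {n : ℕ} (hn : 1 ≤ n)
    (w : Fin n → ℂ) :
    blockDensity κ (axisPoint n (n * ρ)) (tildeNoise κ ρ w) =
      ENNReal.ofReal ((fadingVar κ * n * ρ + 1)⁻¹ * (Real.pi⁻¹ ^ n * Real.exp (-sqNorm w))) := by
  have hP : 0 ≤ n * ρ := by positivity
  have hv := fadingVar_pos hκ
  have h1 : ∀ i, cgDensity (axisMean κ (n * ρ) i) (axisVar κ (n * ρ) i) (tildeNoise κ ρ w i) =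
      ENNReal.ofReal (axisVar κ (n * ρ) i)⁻¹ * cgDensity 0 1 (w i) := by
    intro i
    have ha := axisVar_pos hκ hP i
    rw [tildeNoise_apply, cgDensity, cgDensity, ← ENNReal.ofReal_mul (by positivity),
      add_sub_cancel_left, norm_mul, Complex.norm_real, mul_pow, Real.norm_eq_abs, sq_abs,
      Real.sq_sqrt ha.le, mul_div_cancel_left₀ _ ha.ne', sub_zero, div_one, mul_one, mul_inv]
    congr 1
    ring
  rw [blockDensity_axisPoint hκ hP hn]
  simp only [h1]
  rw [Finset.prod_mul_distrib,
    ← ENNReal.ofReal_prod_of_nonneg fun i _ => (inv_pos.2 (axisVar_pos hκ hP i)).le]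
  have h2 := prod_cgDensity (0 : Fin n → ℂ) w
  simp only [Pi.zero_apply, sub_zero] at h2
  have h3 : ∏ i : Fin n, (axisVar κ (n * ρ) i)⁻¹ = (fadingVar κ * n * ρ + 1)⁻¹ := by
    obtain ⟨j, rfl⟩ : ∃ j, n = j + 1 := ⟨n - 1, by omega⟩
    simp [axisVar, mul_assoc]
  rw [h2, h3, ← ENNReal.ofReal_mul (by positivity)]

/-- Expectations over the noise at `tildeNoise` are expectations over the channel output for the
axis input, since both laws are products of the same Gaussians. -/
theorem map_tildeNoise_noiseLaw {κ ρ : ℝ} (hκ : 0 ≤ κ) (hρ : 0 < ρ) (ℓ : ℕ) {n : ℕ} (hn : 1 ≤ n) :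
    (noiseLaw ℓ n).map (fun w k => tildeNoise κ ρ (w k)) =
      volume.withDensity fun y : Packet ℓ n => ∏ k, blockDensity κ (axisPoint n (n * ρ)) (y k) := by
  have hP : 0 ≤ n * ρ := by positivity
  have h1 : (Measure.pi fun _ : Fin n => complexGaussian 0 1).map (tildeNoise κ ρ) =
      Measure.pi fun i => complexGaussian (axisMean κ (n * ρ) i) (axisVar κ (n * ρ) i) := by
    have hT : tildeNoise κ ρ = fun (w : Fin n → ℂ) i =>
        (fun z : ℂ => axisMean κ (n * ρ) i + (√(axisVar κ (n * ρ) i) : ℂ) * z) (w i) := by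
      funext w i
      exact tildeNoise_apply κ ρ w i
    have he : ∀ i : Fin n, (complexGaussian 0 1).map
        (fun z : ℂ => axisMean κ (n * ρ) i + (√(axisVar κ (n * ρ) i) : ℂ) * z) =
        complexGaussian (axisMean κ (n * ρ) i) (axisVar κ (n * ρ) i) := fun i => by
      rw [complexGaussian_map_affine, Real.sq_sqrt (axisVar_pos hκ hP i).le]
    have : ∀ i : Fin n, SigmaFinite ((complexGaussian 0 1).map
        (fun z : ℂ => axisMean κ (n * ρ) i + (√(axisVar κ (n * ρ) i) : ℂ) * z)) := fun i => by
      rw [he i]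
      infer_instance
    rw [hT, Measure.pi_map_pi (f := fun (i : Fin n) (z : ℂ) =>
      axisMean κ (n * ρ) i + (√(axisVar κ (n * ρ) i) : ℂ) * z) fun i => by fun_prop]
    simp only [he]
  have hp : ∀ k : Fin ℓ, IsProbabilityMeasure
      ((Measure.pi fun _ : Fin n => complexGaussian 0 1).map (tildeNoise κ ρ)) := fun k => by
    rw [h1]
    infer_instance
  unfold noiseLaw
  rw [Measure.pi_map_pi (f := fun _ => tildeNoise κ ρ)
    fun k => (measurable_tildeNoise κ ρ).aemeasurable]
  refine pi_fin_eq_withDensity (μ := fun _ => volume)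
    (f := fun _ => blockDensity κ (axisPoint n (n * ρ)))
    (fun k => measurable_blockDensity_right κ _) fun k => ?_
  rw [h1, pi_fin_eq_withDensity (μ := fun _ => volume) (fun i => measurable_cgDensity _ _)
    fun i => complexGaussian_eq_withDensity _ (axisVar_pos hκ hP i)]
  congr 1
  funext y
  exact (blockDensity_axisPoint hκ hP hn y).symm

/-- This identifies `S_k` as the information density `log (p / q)` of one block, evaluated at the
output for the axis input. -/
theorem mixDensity_tildeNoise {κ ρ : ℝ} (hκ : 0 ≤ κ) (hρ : 0 < ρ) {n : ℕ} (hn : 1 ≤ n)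
    {w : Fin n → ℂ} (hw : 0 < sqNorm (tildeNoise κ ρ w)) :
    mixDensity κ (n * ρ) (tildeNoise κ ρ w) = ENNReal.ofReal (Real.exp (-blockS κ ρ w)) *
      blockDensity κ (axisPoint n (n * ρ)) (tildeNoise κ ρ w) := by
  obtain ⟨h1, h2⟩ := mixDensity_eq_besselIntegral hκ hρ hn hw
  have hv := fadingVar_pos hκ
  have hG : 0 < Real.Gamma n := Real.Gamma_pos_of_pos (by exact_mod_cast hn)
  have hJ : 0 < fadingVar κ * n * ρ + 1 := by positivity
  rw [h1, blockDensity_axisPoint_tildeNoise hκ hρ hn, ← ENNReal.ofReal_mul (Real.exp_pos _).le]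
  congr 1
  have he : Real.exp (-blockS κ ρ w) =
      Real.exp (-(fadingMean κ ^ 2 / fadingVar κ) - sqNorm (tildeNoise κ ρ w)) *
        Real.exp (sqNorm w) * ((fadingVar κ * n * ρ + 1) / fadingVar κ) * Real.Gamma n *
          besselIntegral κ ρ n (sqNorm (tildeNoise κ ρ w)) := by
    rw [← Real.exp_log (div_pos hJ hv), ← Real.exp_log hG, ← Real.exp_log h2, ← Real.exp_add,
      ← Real.exp_add, ← Real.exp_add, ← Real.exp_add]
    congr 1
    unfold blockS
    ring
  rw [he, Real.exp_neg (sqNorm w)]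
  field_simp

/-- The output law has a density, so no block vanishes almost surely; this discards the exceptional
point of the Bessel formula. -/
theorem ae_sqNorm_tildeNoise_pos {κ ρ : ℝ} (hκ : 0 ≤ κ) (hρ : 0 < ρ) (ℓ : ℕ) {n : ℕ} (hn : 1 ≤ n) :
    ∀ᵐ w ∂(noiseLaw ℓ n), ∀ k, 0 < sqNorm (tildeNoise κ ρ (w k)) := by
  have hT : Measurable fun (w : Packet ℓ n) (k : Fin ℓ) => tildeNoise κ ρ (w k) :=
    measurable_pi_lambda _ fun k => (measurable_tildeNoise κ ρ).comp (measurable_pi_apply k)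
  have hy : ∀ᵐ y ∂((noiseLaw ℓ n).map fun w k => tildeNoise κ ρ (w k)), ∀ k, 0 < sqNorm (y k) := by
    rw [map_tildeNoise_noiseLaw hκ hρ ℓ hn]
    suffices h : ∀ᵐ y : Packet ℓ n, ∀ k, 0 < sqNorm (y k) from
      (withDensity_absolutelyContinuous _ _).ae_le h
    rw [ae_all_iff]
    intro k
    have : Nonempty (Fin n) := ⟨⟨0, hn⟩⟩
    have hk : ∀ᵐ y : Packet ℓ n, y k ≠ 0 := Measure.ae_eval_ne (μ := fun _ => volume) k 0
    filter_upwards [hk] with y hy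
    obtain ⟨i, hi⟩ := Function.ne_iff.1 hy
    have hi' : 0 < ‖y k i‖ ^ 2 := pow_pos (norm_pos_iff.2 hi) 2
    exact hi'.trans_le
      (Finset.single_le_sum (f := fun i => ‖y k i‖ ^ 2) (fun _ _ => sq_nonneg _) (Finset.mem_univ i))
  exact ae_of_ae_map hT.aemeasurable hy

end RicianBlockFading

/-! ### From the likelihood ratio to the error bound and the code -/

theorem measurable_comp_uncurry {α β γ δ : Type*} [MeasurableSpace α] [MeasurableSpace β]
    [MeasurableSpace γ] [MeasurableSpace δ] {f : α → β → γ} (hf : Measurable (Function.uncurry f))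
    {a : δ → α} {b : δ → β} (ha : Measurable a) (hb : Measurable b) :
    Measurable fun z => f (a z) (b z) :=
  hf.comp (ha.prodMk hb)

namespace RicianBlockFading

theorem measurable_prod_mixDensity (κ P : ℝ) (ℓ n : ℕ) :
    Measurable fun y : Packet ℓ n => ∏ k, mixDensity κ P (y k) :=
  Finset.measurable_fun_prod _ fun k _ => (measurable_mixDensity κ P).comp (measurable_pi_apply k)

theorem measurable_tildeNoise_packet (κ ρ : ℝ) (ℓ n : ℕ) :
    Measurable fun (w : Packet ℓ n) (k : Fin ℓ) => tildeNoise κ ρ (w k) :=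
  measurable_pi_lambda _ fun k => (measurable_tildeNoise κ ρ).comp (measurable_pi_apply k)

theorem blockDensity_ne_top (κ : ℝ) {n : ℕ} (x y : Fin n → ℂ) : blockDensity κ x y ≠ ∞ :=
  ne_top_of_le_ne_top ENNReal.ofReal_ne_top (blockDensity_le κ x y)

theorem prod_blockDensity_ne_zero (κ : ℝ) {ℓ n : ℕ} (x y : Packet ℓ n) :
    ∏ k, blockDensity κ (x k) (y k) ≠ 0 :=
  Finset.prod_ne_zero_iff.2 fun k _ => (blockDensity_pos κ (x k) (y k)).ne'

theorem prod_blockDensity_ne_top (κ : ℝ) {ℓ n : ℕ} (x y : Packet ℓ n) :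
    ∏ k, blockDensity κ (x k) (y k) ≠ ∞ :=
  ENNReal.prod_ne_top fun k _ => blockDensity_ne_top κ (x k) (y k)

/-- Likelihood ratio of the output density and the transition density for the input
`axisPoint`. -/
noncomputable def axisRatio (κ ρ : ℝ) {ℓ n : ℕ} (y : Packet ℓ n) : ℝ≥0∞ :=
  (∏ k, mixDensity κ (n * ρ) (y k)) / ∏ k, blockDensity κ (axisPoint n (n * ρ)) (y k)

theorem measurable_axisRatio (κ ρ : ℝ) {ℓ n : ℕ} :
    Measurable (axisRatio κ ρ : Packet ℓ n → ℝ≥0∞) :=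
  (measurable_prod_mixDensity κ (n * ρ) ℓ n).div
    (measurable_prod_blockDensity κ fun _ : Fin ℓ => axisPoint n (n * ρ))

theorem ae_axisRatio_tildeNoise {κ ρ : ℝ} (hκ : 0 ≤ κ) (hρ : 0 < ρ) (ℓ : ℕ) {n : ℕ} (hn : 1 ≤ n) :
    ∀ᵐ w ∂(noiseLaw ℓ n), axisRatio κ ρ (fun k => tildeNoise κ ρ (w k)) =
      ENNReal.ofReal (Real.exp (-∑ k, blockS κ ρ (w k))) := by
  filter_upwards [ae_sqNorm_tildeNoise_pos hκ hρ ℓ hn] with w hw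
  rw [axisRatio, Finset.prod_congr rfl fun k _ => mixDensity_tildeNoise hκ hρ hn (hw k),
    Finset.prod_mul_distrib, ENNReal.mul_div_cancel_right
      (prod_blockDensity_ne_zero κ (fun _ => axisPoint n (n * ρ)) fun k => tildeNoise κ ρ (w k))
      (prod_blockDensity_ne_top κ (fun _ => axisPoint n (n * ρ)) fun k => tildeNoise κ ρ (w k)),
    ← ENNReal.ofReal_prod_of_nonneg fun k _ => (Real.exp_pos _).le, ← Real.exp_sum,
    Finset.sum_neg_distrib]

/-- Almost everywhere the sum is minus the logarithm of the measurable likelihood ratio, which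
bypasses measurability of the Bessel integral. -/
theorem aemeasurable_sum_blockS {κ ρ : ℝ} (hκ : 0 ≤ κ) (hρ : 0 < ρ) (ℓ : ℕ) {n : ℕ} (hn : 1 ≤ n) :
    AEMeasurable (fun w : Packet ℓ n => ∑ k, blockS κ ρ (w k)) (noiseLaw ℓ n) := by
  refine ⟨fun w => -Real.log (axisRatio κ ρ fun k => tildeNoise κ ρ (w k)).toReal, ?_, ?_⟩
  · exact (Real.measurable_log.comp ((measurable_axisRatio κ ρ).comp
      (measurable_tildeNoise_packet κ ρ ℓ n)).ennreal_toReal).neg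
  · filter_upwards [ae_axisRatio_tildeNoise hκ hρ ℓ hn] with w hw
    rw [hw, ENNReal.toReal_ofReal (Real.exp_pos _).le, Real.log_exp, neg_neg]

theorem aestronglyMeasurable_epsUb_integrand {κ ρ : ℝ} (hκ : 0 ≤ κ) (hρ : 0 < ρ) (ℓ : ℕ) {n : ℕ}
    (hn : 1 ≤ n) (c : ℝ) :
    AEStronglyMeasurable (fun w : Packet ℓ n =>
      Real.exp (-(max 0 ((∑ k, blockS κ ρ (w k)) - c)))) (noiseLaw ℓ n) := by
  have hm : Measurable fun s : ℝ => Real.exp (-(max 0 (s - c))) := by fun_prop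
  exact (hm.comp_aemeasurable (aemeasurable_sum_blockS hκ hρ ℓ hn)).aestronglyMeasurable

theorem exp_neg_max_le_one (a : ℝ) : Real.exp (-(max 0 a)) ≤ 1 :=
  Real.exp_le_one_iff.2 (neg_nonpos.2 (le_max_left 0 a))

theorem min_one_mul_exp_neg {γ s : ℝ} (hγ : 0 < γ) :
    min 1 (ENNReal.ofReal γ * ENNReal.ofReal (Real.exp (-s))) =
      ENNReal.ofReal (Real.exp (-(max 0 (s - Real.log γ)))) := by
  have h : γ * Real.exp (-s) = Real.exp (-(s - Real.log γ)) := by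
    rw [neg_sub, sub_eq_add_neg, Real.exp_add, Real.exp_log hγ]
  rw [← ENNReal.ofReal_mul hγ.le, h, ← ENNReal.ofReal_one, ← ENNReal.ofReal_min]
  congr 1
  rcases le_total 0 (s - Real.log γ) with h0 | h0
  · rw [max_eq_right h0, min_eq_right (Real.exp_le_one_iff.2 (by linarith))]
  · rw [max_eq_left h0, neg_zero, Real.exp_zero, min_eq_left (Real.one_le_exp (by linarith))]

/-- Factor `min (p, γ q) = p * min (1, γ q / p)` and read `p` as the law of `tildeNoise`; the second
factor is then the integrand of `epsUb`. -/
theorem lintegral_min_axisPoint {κ ρ : ℝ} (hκ : 0 ≤ κ) (hρ : 0 < ρ) (ℓ : ℕ) {n : ℕ} (hn : 1 ≤ n)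
    {M : ℕ} (hM : 2 ≤ M) :
    ∫⁻ y : Packet ℓ n, min (∏ k, blockDensity κ (axisPoint n (n * ρ)) (y k))
        (ENNReal.ofReal (((M : ℝ) - 1) / 2) * ∏ k, mixDensity κ (n * ρ) (y k)) =
      ENNReal.ofReal (epsUb κ ρ ℓ n M) := by
  have hγ : 0 < ((M : ℝ) - 1) / 2 := by
    have : (2 : ℝ) ≤ M := by exact_mod_cast hM
    linarith
  set γ := ((M : ℝ) - 1) / 2
  let p : Packet ℓ n → ℝ≥0∞ := fun y => ∏ k, blockDensity κ (axisPoint n (n * ρ)) (y k)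
  have hp : Measurable p := measurable_prod_blockDensity κ fun _ : Fin ℓ => axisPoint n (n * ρ)
  let ψ : Packet ℓ n → ℝ≥0∞ := fun y => min 1 (ENNReal.ofReal γ * axisRatio κ ρ y)
  have hψ : Measurable ψ := measurable_const.min ((measurable_axisRatio κ ρ).const_mul _)
  have h1 : ∀ y : Packet ℓ n, min (∏ k, blockDensity κ (axisPoint n (n * ρ)) (y k))
      (ENNReal.ofReal γ * ∏ k, mixDensity κ (n * ρ) (y k)) = (p * ψ) y := by
    intro y
    have h0 := prod_blockDensity_ne_zero κ (fun _ => axisPoint n (n * ρ)) y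
    have ht := prod_blockDensity_ne_top κ (fun _ => axisPoint n (n * ρ)) y
    simp only [Pi.mul_apply, p, ψ, axisRatio]
    rw [mul_min, mul_one, mul_left_comm, ENNReal.mul_div_cancel h0 ht]
  have hle : ∀ᵐ w ∂(noiseLaw ℓ n), ψ (fun k => tildeNoise κ ρ (w k)) =
      ENNReal.ofReal (Real.exp (-(max 0 ((∑ k, blockS κ ρ (w k)) - Real.log γ)))) := by
    filter_upwards [ae_axisRatio_tildeNoise hκ hρ ℓ hn] with w hw
    simp only [ψ]
    rw [hw, min_one_mul_exp_neg hγ]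
  have hint : Integrable (fun w : Packet ℓ n =>
      Real.exp (-(max 0 ((∑ k, blockS κ ρ (w k)) - Real.log γ)))) (noiseLaw ℓ n) := by
    refine Integrable.of_bound (aestronglyMeasurable_epsUb_integrand hκ hρ ℓ hn _) 1 ?_
    refine Filter.Eventually.of_forall fun w => ?_
    rw [Real.norm_of_nonneg (Real.exp_pos _).le]
    exact exp_neg_max_le_one _
  rw [lintegral_congr h1, ← lintegral_withDensity_eq_lintegral_mul _ hp hψ,
    ← map_tildeNoise_noiseLaw hκ hρ ℓ hn, lintegral_map hψ (measurable_tildeNoise_packet κ ρ ℓ n),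
    lintegral_congr_ae hle, ← ofReal_integral_eq_lintegral_ofReal hint
      (Filter.Eventually.of_forall fun w => (Real.exp_pos _).le), epsUb, if_neg (by omega)]

/-- Change variables by one unitary map per block: it carries the spherical codeword's density to
that of the axis input and fixes the mixture density. `P > 0` keeps the axis point nonzero. -/
theorem lintegral_min_spherePoint {κ P : ℝ} (hP : 0 < P) {ℓ n : ℕ} (hn : 1 ≤ n) (γ : ℝ≥0∞)
    (u : Fin ℓ → Metric.sphere (0 : EuclideanSpace ℂ (Fin n)) 1) :
    ∫⁻ y : Packet ℓ n, min (∏ k, blockDensity κ (spherePoint P (u k)) (y k))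
        (γ * ∏ k, mixDensity κ P (y k)) =
      ∫⁻ y : Packet ℓ n, min (∏ k, blockDensity κ (axisPoint n P) (y k))
        (γ * ∏ k, mixDensity κ P (y k)) := by
  have hx : axisPoint n P ≠ 0 := by
    intro h
    have := sqNorm_axisPoint hn hP.le
    rw [h] at this
    simp [sqNorm] at this
    exact hP.ne this
  have hT := fun k => exists_measurePreserving_blockDensity_eq κ (axisPoint n P)
    (spherePoint P (u k)) ((sqNorm_axisPoint hn hP.le).trans (sqNorm_spherePoint hP.le _).symm) hx
  choose T hT1 hT2 hT3 using hT
  have hmp : MeasurePreserving fun (y : Packet ℓ n) k => T k (y k) := volume_preserving_pi hT1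
  have hm : Measurable fun y : Packet ℓ n => min (∏ k, blockDensity κ (spherePoint P (u k)) (y k))
      (γ * ∏ k, mixDensity κ P (y k)) :=
    (measurable_prod_blockDensity κ fun k => spherePoint P (u k)).min
      ((measurable_prod_mixDensity κ P ℓ n).const_mul γ)
  rw [← hmp.lintegral_comp hm]
  refine lintegral_congr fun y => ?_
  simp only [hT3]
  congr 2
  exact Finset.prod_congr rfl fun k _ => mixDensity_congr κ hP.le hn (hT2 k (y k))

theorem nonempty_code_of_epsUb_le {κ ρ ε : ℝ} (hκ : 0 ≤ κ) (hρ : 0 < ρ) (ℓ : ℕ) {n : ℕ} (hn : 1 ≤ n)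
    {M : ℕ} (hM : 2 ≤ M) (hε : epsUb κ ρ ℓ n M ≤ ε) : Nonempty (Code κ ρ ε ℓ n M) := by
  have hn0 : (0 : ℝ) < n := by exact_mod_cast hn
  have hP : 0 < n * ρ := by positivity
  have : NeZero M := ⟨by omega⟩
  have := isProbabilityMeasure_unifSphere hn
  let p : (Fin ℓ → Metric.sphere (0 : EuclideanSpace ℂ (Fin n)) 1) → Packet ℓ n → ℝ≥0∞ :=
    fun u y => ∏ k, blockDensity κ (spherePoint (n * ρ) (u k)) (y k)
  have hp : Measurable (Function.uncurry p) := by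
    refine Finset.measurable_fun_prod _ fun k _ => ?_
    have h1 : Measurable fun z : (Fin ℓ → Metric.sphere (0 : EuclideanSpace ℂ (Fin n)) 1) ×
        Packet ℓ n => spherePoint (n * ρ) (z.1 k) :=
      (measurable_spherePoint _).comp ((measurable_pi_apply k).comp measurable_fst)
    have h2 : Measurable fun z : (Fin ℓ → Metric.sphere (0 : EuclideanSpace ℂ (Fin n)) 1) ×
        Packet ℓ n => z.2 k := (measurable_pi_apply k).comp measurable_snd
    exact measurable_comp_uncurry (measurable_blockDensity κ) h1 h2
  obtain ⟨c, g, hg, hcg⟩ := dependence_testing_bound (Measure.pi fun _ : Fin ℓ => unifSphere n)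
    (volume : Measure (Packet ℓ n)) p hp M
  have hq : ∀ y : Packet ℓ n, ∫⁻ u, p u y ∂(Measure.pi fun _ : Fin ℓ => unifSphere n) =
      ∏ k, mixDensity κ (n * ρ) (y k) := fun y =>
    lintegral_pi_fin_prod (fun _ : Fin ℓ => unifSphere n)
      (fun k u => blockDensity κ (spherePoint (n * ρ) u) (y k)) fun k =>
        ((measurable_blockDensity κ).of_uncurry_right).comp (measurable_spherePoint _)
  simp only [hq, p] at hcg
  -- The inner integral no longer depends on the codeword, so averaging over the input law is
  -- trivial.
  simp only [lintegral_min_spherePoint hP hn, lintegral_min_axisPoint hκ hρ ℓ hn hM] at hcg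
  rw [lintegral_const, measure_univ, mul_one] at hcg
  let enc : Fin M → Packet ℓ n := fun j k => spherePoint (n * ρ) (c j k)
  have herr : ∀ j, (outputLaw κ (enc j)) {y | g y ≠ j} =
      ∫⁻ y in {y | g y ≠ j}, ∏ k, blockDensity κ (spherePoint (n * ρ) (c j k)) (y k) := fun j => by
    have hs : MeasurableSet {y | g y ≠ j} := hg (measurableSet_singleton j).compl
    rw [outputLaw_eq_withDensity, withDensity_apply _ hs]
  refine ⟨⟨enc, g, hg, fun m k => sqNorm_spherePoint hP.le _, ?_⟩⟩
  have hM0 : (0 : ℝ) < M := by positivity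
  have hub : 0 ≤ epsUb κ ρ ℓ n M := by
    rw [epsUb, if_neg (by omega)]
    exact integral_nonneg fun w => (Real.exp_pos _).le
  simp only [← herr] at hcg
  have hfin : ENNReal.ofReal (epsUb κ ρ ℓ n M) ≠ ∞ := ENNReal.ofReal_ne_top
  have hsum : ∑ j, (outputLaw κ (enc j)).real {y | g y ≠ j} ≤ M * epsUb κ ρ ℓ n M := by
    have htop : (M : ℝ≥0∞) * ENNReal.ofReal (epsUb κ ρ ℓ n M) ≠ ∞ :=
      ENNReal.mul_ne_top (ENNReal.natCast_ne_top M) hfin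
    have h := ENNReal.toReal_mono htop hcg
    rw [ENNReal.toReal_mul, ENNReal.toReal_natCast, ENNReal.toReal_ofReal hub,
      ENNReal.toReal_sum fun j hj => ne_top_of_le_ne_top htop
        ((Finset.single_le_sum (fun _ _ => zero_le) hj).trans hcg)] at h
    exact h
  calc _ ≤ 1 / (M : ℝ) * (M * epsUb κ ρ ℓ n M) := by gcongr
    _ = epsUb κ ρ ℓ n M := by field_simp
    _ ≤ ε := hε

theorem nonempty_code_one (κ : ℝ) {ρ ε : ℝ} (hρ : 0 < ρ) (hε : 0 ≤ ε) (ℓ : ℕ) {n : ℕ} (hn : 1 ≤ n) :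
    Nonempty (Code κ ρ ε ℓ n 1) := by
  refine ⟨⟨fun _ _ => axisPoint n (n * ρ), fun _ => 0, measurable_const,
    fun m k => sqNorm_axisPoint hn (by positivity), ?_⟩⟩
  have : ∀ j : Fin 1, {y : Packet ℓ n | (0 : Fin 1) ≠ j} = ∅ := fun j => by
    simp [Subsingleton.elim j 0]
  simp [this, hε]

/-- For each noise value the threshold `log ((M - 1) / 2)` eventually exceeds `∑ S_k`, so the
integrand becomes `1`; dominated convergence applies with bound `1`. -/
theorem tendsto_epsUb {κ ρ : ℝ} (hκ : 0 ≤ κ) (hρ : 0 < ρ) (ℓ : ℕ) {n : ℕ} (hn : 1 ≤ n) :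
    Filter.Tendsto (epsUb κ ρ ℓ n) Filter.atTop (nhds 1) := by
  have hlim : Filter.Tendsto (fun M : ℕ => Real.log (((M : ℝ) - 1) / 2)) Filter.atTop
      Filter.atTop := by
    refine Real.tendsto_log_atTop.comp (Filter.Tendsto.atTop_div_const two_pos ?_)
    exact Filter.tendsto_atTop_add_const_right _ _ tendsto_natCast_atTop_atTop
  have h : Filter.Tendsto (fun M : ℕ => ∫ w : Packet ℓ n,
      Real.exp (-(max 0 ((∑ k, blockS κ ρ (w k)) - Real.log (((M : ℝ) - 1) / 2)))) ∂(noiseLaw ℓ n))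
      Filter.atTop (nhds (∫ _, (1 : ℝ) ∂(noiseLaw ℓ n))) := by
    refine tendsto_integral_of_dominated_convergence (fun _ => 1)
      (fun M => aestronglyMeasurable_epsUb_integrand hκ hρ ℓ hn _) (integrable_const 1)
      (fun M => Filter.Eventually.of_forall fun w => ?_) (Filter.Eventually.of_forall fun w => ?_)
    · rw [Real.norm_of_nonneg (Real.exp_pos _).le]
      exact exp_neg_max_le_one _
    · refine tendsto_const_nhds.congr' ?_
      filter_upwards [hlim.eventually_ge_atTop (∑ k, blockS κ ρ (w k))] with M hM
      rw [max_eq_left (by linarith), neg_zero, Real.exp_zero]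
  rw [integral_const, probReal_univ, one_smul] at h
  refine h.congr' ?_
  filter_upwards [Filter.eventually_ge_atTop 2] with M hM
  rw [epsUb, if_neg (by omega)]

end RicianBlockFading

theorem theorem1 (κ ρ ε : ℝ) (ℓ nc : ℕ) (hκ : 0 ≤ κ) (hρ : 0 < ρ) (hε0 : 0 ≤ ε) (hε1 : ε < 1)
    (hℓ : 1 ≤ ℓ) (hnc : 1 ≤ nc) :
    ∃ r : ℝ,
      IsGreatest {r : ℝ | ∃ M : ℕ, 1 ≤ M ∧ RicianBlockFading.epsUb κ ρ ℓ nc M ≤ ε ∧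
        r = RicianBlockFading.rate ℓ nc M} r ∧
      (r : EReal) ≤ RicianBlockFading.maxRate κ ρ ε ℓ nc := by
  open RicianBlockFading in
  obtain ⟨N, hN⟩ := Filter.eventually_atTop.1 ((tendsto_epsUb hκ hρ ℓ hnc).eventually_const_lt hε1)
  have hfin : {M : ℕ | 1 ≤ M ∧ epsUb κ ρ ℓ nc M ≤ ε}.Finite := by
    refine (Set.finite_lt_nat N).subset fun M hM => ?_
    by_contra h
    exact absurd hM.2 (not_le.2 (hN M (not_lt.1 h)))
  have hne : {M : ℕ | 1 ≤ M ∧ epsUb κ ρ ℓ nc M ≤ ε}.Nonempty := ⟨1, le_rfl, by simpa [epsUb] using hε0⟩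
  obtain ⟨M, ⟨hM1, hMε⟩, hmax⟩ := Set.exists_max_image _ (rate ℓ nc) hfin hne
  refine ⟨rate ℓ nc M, ⟨⟨M, hM1, hMε, rfl⟩, ?_⟩, le_sSup ⟨M, ?_, rfl⟩⟩
  · rintro _ ⟨M', h1, h2, rfl⟩
    exact hmax M' ⟨h1, h2⟩
  -- A single message is never decoded wrongly. It is treated apart because the logarithmic form of
  -- the bound needs `(M - 1) / 2 > 0`.
  · rcases hM1.eq_or_lt with rfl | hM2
    · exact nonempty_code_one κ hρ hε0 ℓ hnc
    · exact nonempty_code_of_epsUb_le hκ hρ ℓ hnc hM2 hMε
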